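/- **Setting.** A graph $G=(V,m,E,a)$ consists of an at most countable vertex set $V$, masses $m:V\to(0,\infty)$, and weights $a:V\times V\to[0,\infty)$ with locally finite support $E=\{(i,j):a(i,j)>0\}$; the edge $(i,j)$ starts at $j$ and ends at $i$. With $d^-(v)=\sum_i a(v,i)$ and $d^+(v)=\sum_j a(j,v)$ assume that there is a constant $c$ with $d^\pm(v)\le c\,m(v)$ for all $v$. On $\ell^2(G)=\ell^2(V,m)$, with $\langle f,g\rangle=\sum_v\overline{f(v)}g(v)m(v)$, the in- and out-degree Laplacians are $$[L^{\mp}f](x)=\frac1{m(x)}\Big(d^{\mp}(x)f(x)-\sum_{y}a(x,y)f(y)\Big).$$ Let $\tilde E\subseteq E$ be a finite set of edges (the union of finitely many finite clusters), let $L^+_{E\setminus\tilde E}$ and $L^+_{\tilde E}$ be the out-degree Laplacians of $(V,m)$ with $a$ restricted to $E\setminus\tilde E$ and to $\tilde E$, and put $L^+_\beta=L^+_{E\setminus\tilde E}+\beta L^+_{\tilde E}$. **Reaches.** In a graph, $i$ *sees* $j$ if there is a directed path (possibly of length $0$) from $j$ to $i$. A *reach* is a maximal set among the sets $\{j: j\text{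 sees }i\}$, $i\in V$. The common part $C(R)$ of a reach $R$ is the set of its vertices that see a vertex of another reach; the exclusive part is $H(R)=R\setminus C(R)$. To a reach $R$ of a graph with finitely many edges we attach two vectors: * the harmonic vector $h_R$, equal to $1$ on $H(R)$, to $0$ off $R$, and to $-(L^-_{CC})^{-1}(L^-_{CH}\mathbf 1)$ on $C=C(R)$, where $L^-_{CC},L^-_{CH}$ are the blocks of the in-degree Laplacian belonging to $C=C(R)$ and $H=H(R)$; * the normalized weight vector $w_R$, proportional to $\omega_R(i)=\sum_\tau\prod_{(x,y)\in\tau}a(x,y)$ (sum over the directed spanning trees $\tau$ of $R$ rooted at $i$), with $\sum_j m(j)w_R(j)=1$. **Reduced graphs.** Let $\tilde G^\intercal=(V,m,\tilde E^\intercal,a^\intercal)$ be the transposed cluster graph, in which all edges of $\tilde E$ are reversed. For a reach $R$ of $\tilde G^\intercal$ let $\overleftarrow\gamma^+_R=h_R$ and $\overrightarrow\gamma^+_R=w_R$, computed in $\tilde G^\intercal$, and let $P^+=\sum_R\overrightarrow\gamma^+_R\langle\overleftarrow\gamma^+_R,\cdot\rangle$. The graph $\underline G^+$ has the reaches of $\tilde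 G^\intercal$ as nodes, and $$\underline m^+(S)=\langle\chi_S,P^+\chi_S\rangle,\qquad \underline a^+(R,S)=\Big(\sum_{r\in R,\,s\in S}\overleftarrow\gamma^+_R(r)\,a(r,s)\,\overrightarrow\gamma^+_S(s)\Big)\underline m^+(S).$$ The graph $\underline G^-$ is defined from the reaches of the cluster graph $\tilde G=(V,m,\tilde E,a|_{\tilde E})$ itself, with $\overrightarrow\gamma^-_R=h_R$ and $\overleftarrow\gamma^-_R=w_R$ computed in $\tilde G$, $P^-=\sum_R\overrightarrow\gamma^-_R\langle\overleftarrow\gamma^-_R,\cdot\rangle$, and $$\underline m^-(S)=\langle\chi_S,P^-\chi_S\rangle,\qquad \underline a^-(R,S)=\underline m^-(R)\sum_{r\in R,\,s\in S}\overleftarrow\gamma^-_R(r)\,a(r,s)\,\overrightarrow\gamma^-_S(s).$$ Further let $[J^+_\downarrow f](R)=\langle\overleftarrow\gamma^+_R,f\rangle/\underline m^+(R)$ and $J^+_\uparrow\underline f=\sum_R\underline m^+(R)\,\underline f(R)\,\overrightarrow\gamma^+_R$. **Theorem.** $\underline G^+$ is again a graph in the above sense (positive masses, nonnegative and locally finite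 weights, degrees bounded relative to the masses). The out-degree Laplacians $L^+_{E\setminus\tilde E}$, $L^+_{\tilde E}$ and $\underline L^+$ (that of $\underline G^+$) and the maps $J^+_\downarrow:\ell^2(G)\to\ell^2(\underline G^+)$, $J^+_\uparrow:\ell^2(\underline G^+)\to\ell^2(G)$ are everywhere defined bounded operators, and $J^+_\uparrow J^+_\downarrow$ is the Riesz projection of $L^+_{\tilde E}$ for the point $0$ (which is not an accumulation point of $\sigma(L^+_{\tilde E})$). For every $z$ in the resolvent set of $\underline L^+$ there are constants $C,\beta_0>0$ such that for all $\beta\ge\beta_0$ the point $z$ lies in the resolvent set of $L^+_\beta$ and $$\big\|(L^+_\beta-z)^{-1}-J^+_\uparrow(\underline L^+-z)^{-1}J^+_\downarrow\big\|\le\frac C\beta .$$ Moreover $\underline G^+$ is in general different from $\underline G^-$: there are a graph on three vertices and a set $\tilde E\subseteq E$ for which both reduced graphs are graphs in the above sense, but are not isomorphic as weighted graphs. -/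

import Mathlib

open scoped Matrix

noncomputable section

/-- The Hilbert-space measure of a mass function: each vertex `v` is an atom of mass `m v`
(every subset of `V` is measurable). -/
def massMeasure {V : Type*} (m : V → ℝ) : @MeasureTheory.Measure V ⊤ :=
  @MeasureTheory.Measure.sum V V ⊤
    fun v => ENNReal.ofReal (m v) • @MeasureTheory.Measure.dirac V ⊤ v

/-- `ℓ²(V, m)`: complex functions with `∑ |f v|² m v < ∞` and the inner product
`⟪f, g⟫ = ∑ conj (f v) * g v * m v`.  When all masses are positive, almost everywhere equality
is equality, so the values `f v` are well defined. -/
abbrev WeightedL2 {V : Type*} (m : V → ℝ) : Type _ :=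
  @MeasureTheory.Lp V ℂ ⊤ _ 2 (massMeasure m)

/-- A weighted directed graph on the vertex set `V`, with masses `m` and edge weights `a`.
The edge set is the support of `a`; it is locally finite.  The pair `(i, j)` is the edge that
originates at `j` and terminates at `i`. -/
structure WGraph (V : Type*) where
  m : V → ℝ
  a : V → V → ℝ
  m_pos : ∀ v, 0 < m v
  a_nonneg : ∀ v w, 0 ≤ a v w
  finite_in : ∀ v, {w | 0 < a v w}.Finite
  finite_out : ∀ v, {w | 0 < a w v}.Finite

namespace WGraph

variable {V : Type*}

/-- The edge set. -/
def edges (G : WGraph V) : Set (V × V) := {e | 0 < G.a e.1 e.2}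

/-- The graph with all edges reversed. -/
def transpose (G : WGraph V) : WGraph V where
  m := G.m
  a := fun i j => G.a j i
  m_pos := G.m_pos
  a_nonneg := fun v w => G.a_nonneg w v
  finite_in := G.finite_out
  finite_out := G.finite_in

open Classical in
/-- The graph `(V, m, E ∩ F, a restricted to F)`, in which only the edges in `F` are kept. -/
def restrict (G : WGraph V) (F : Set (V × V)) : WGraph V where
  m := G.m
  a := fun i j => if (i, j) ∈ F then G.a i j else 0
  m_pos := G.m_pos
  a_nonneg := fun v w => by
    split_ifs
    · exact G.a_nonneg v w
    · exact le_rfl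
  finite_in := fun v => (G.finite_in v).subset fun w hw => by
    simp only [Set.mem_ofPred_eq] at hw ⊢
    split_ifs at hw
    · exact hw
    · exact absurd hw (lt_irrefl _)
  finite_out := fun v => (G.finite_out v).subset fun w hw => by
    simp only [Set.mem_ofPred_eq] at hw ⊢
    split_ifs at hw
    · exact hw
    · exact absurd hw (lt_irrefl _)

/-- In-degree. -/
def degIn (G : WGraph V) (v : V) : ℝ := ∑' i, G.a v i

/-- Out-degree. -/
def degOut (G : WGraph V) (v : V) : ℝ := ∑' j, G.a j v

/-- In- and out-degrees are uniformly bounded relative to the node masses. -/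
def DegreeBounded (G : WGraph V) : Prop :=
  ∃ C : ℝ, 0 < C ∧ ∀ v, G.degIn v ≤ C * G.m v ∧ G.degOut v ≤ C * G.m v

/-- `T` is the out-degree Laplacian of `G`, a bounded operator on all of `ℓ²(G)`. -/
def IsOutLaplacian (G : WGraph V) (T : WeightedL2 G.m →L[ℂ] WeightedL2 G.m) : Prop :=
  ∀ (f : WeightedL2 G.m) (x : V),
    T f x = (1 / (G.m x : ℂ)) * ((G.degOut x : ℂ) * f x - ∑' y, (G.a x y : ℂ) * f y)

/-! ### Reaches -/

/-- `i` sees `j`: there is a directed path (possibly of length zero), with edges in `F`,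
that starts at `j` and ends at `i`. -/
def Sees (F : Set (V × V)) (i j : V) : Prop :=
  Relation.ReflTransGen (fun x y => (x, y) ∈ F) i j

/-- The set of all vertices that can be reached from `i`. -/
def reachableSet (G : WGraph V) (i : V) : Set V := {j | Sees G.edges j i}

/-- A reach is a maximal reachable set. -/
def IsReach (G : WGraph V) (R : Set V) : Prop :=
  Maximal (fun S => ∃ i, S = G.reachableSet i) R

/-- The type of reaches of a graph. -/
def Reach (G : WGraph V) : Type _ := {R : Set V // G.IsReach R}

/-- The exclusive part: vertices of `R` that see no node of any other reach. -/
def exclusivePart (G : WGraph V) (R : Set V) : Set V :=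
  {v | v ∈ R ∧ ∀ S, G.IsReach S → S ≠ R → ∀ w ∈ S, ¬ Sees G.edges v w}

/-- The common part: vertices of `R` that also see nodes of other reaches. -/
def commonPart (G : WGraph V) (R : Set V) : Set V :=
  {v | v ∈ R ∧ ∃ S, G.IsReach S ∧ S ≠ R ∧ ∃ w ∈ S, Sees G.edges v w}

/-! ### The two kernel vectors attached to a reach -/

open Classical in
/-- The matrix entries of the in-degree Laplacian `L⁻`: `(L⁻ f) x = ∑ y, lapIn x y * f y`. -/
def lapIn (G : WGraph V) (x y : V) : ℝ :=
  ((if x = y then G.degIn x else 0) - G.a x y) / G.m x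

open Classical in
/-- The harmonic vector of a reach `R` (element of the right kernel of the in-degree Laplacian):
it is `1` on the exclusive part `H`, it is `0` outside `R`, and on the common part `C` it is
`-(L_CC)⁻¹ (L_CH 1)`, where `L_CC` and `L_CH` are the blocks of the in-degree Laplacian.
(The common part is finite as soon as the graph has finitely many edges.) -/
def harmonicVec (G : WGraph V) (R : Set V) (j : V) : ℝ :=
  if j ∈ G.exclusivePart R then 1
  else if h : j ∈ G.commonPart R ∧ (G.commonPart R).Finite then
    letI : Fintype (G.commonPart R) := h.2.fintype
    (-((Matrix.of fun x y : G.commonPart R => G.lapIn x y)⁻¹ *ᵥ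
      fun x : G.commonPart R => ∑' y : G.exclusivePart R, G.lapIn x y)) ⟨j, h.1⟩
  else 0

/-- `T` is (the edge set of) a spanning tree of the vertex set `R`, using edges of `G` inside `R`,
directed away from its root `i`: the root has no incoming edge, every other vertex has exactly
one, and every vertex of `R` is reached from the root inside `T`. -/
structure IsSpanningTree (G : WGraph V) (R : Set V) (i : V) (T : Finset (V × V)) : Prop where
  root_mem : i ∈ R
  edge_mem : ∀ e ∈ T, e ∈ G.edges ∧ e.1 ∈ R ∧ e.2 ∈ R
  root_in : ∀ y, (i, y) ∉ T
  unique_in : ∀ x ∈ R, x ≠ i → ∃! y, (x, y) ∈ T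
  connected : ∀ x ∈ R, Sees (T : Set (V × V)) x i

/-- The weight vector of a reach: its value at `i` is the sum, over all spanning trees of `R`
rooted at `i`, of the products of the edge weights of the tree. -/
def weightVec (G : WGraph V) (R : Set V) (i : V) : ℝ :=
  ∑ᶠ (T : Finset (V × V)) (_ : G.IsSpanningTree R i T), ∏ e ∈ T, G.a e.1 e.2

/-- The weight vector of `R`, rescaled so that `∑ j, γ j * m j = 1`
(element of the left kernel of the in-degree Laplacian). -/
def normalizedWeightVec (G : WGraph V) (R : Set V) (i : V) : ℝ :=
  G.weightVec R i / ∑' j, G.m j * G.weightVec R j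

/-! ### Reduced graphs -/

/-- `⟨χ_S, P χ_S⟩` in `ℓ²(V, m)` for `P = ∑ R, vec R ⟨cev R, ·⟩`. -/
def projMass {ι : Type*} (m : V → ℝ) (vec cev : ι → V → ℝ) (S : Set V) : ℝ :=
  ∑' v : S, (∑' R : ι, vec R v * ∑' u : S, cev R u * m u) * m v

/-- The transposed cluster graph `(V, m, Ẽᵀ, aᵀ)`. -/
abbrev clusterT (G : WGraph V) (F : Set (V × V)) : WGraph V := (G.restrict F).transpose

/-- `γ⃗⁺_R`, for a reach `R` of the transposed cluster graph: right kernel of `L⁺_Ẽ`. -/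
def vecOut (G : WGraph V) (F : Set (V × V)) (R : (G.clusterT F).Reach) : V → ℝ :=
  (G.clusterT F).normalizedWeightVec R.1

/-- `γ⃖⁺_R`, for a reach `R` of the transposed cluster graph: left kernel of `L⁺_Ẽ`. -/
def cevOut (G : WGraph V) (F : Set (V × V)) (R : (G.clusterT F).Reach) : V → ℝ :=
  (G.clusterT F).harmonicVec R.1

/-- The node masses `m̲⁺` of the out-degree reduced graph. -/
def redMassOut (G : WGraph V) (F : Set (V × V)) (S : (G.clusterT F).Reach) : ℝ :=
  projMass G.m (G.vecOut F) (G.cevOut F) S.1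

/-- The edge weights `a̲⁺` of the out-degree reduced graph. -/
def redWeightOut (G : WGraph V) (F : Set (V × V)) (R S : (G.clusterT F).Reach) : ℝ :=
  (∑' r : R.1, ∑' s : S.1, G.cevOut F R r * G.a r s * G.vecOut F S s) * G.redMassOut F S

/-- `H` is the reduced graph `G̲⁺`. -/
def IsReducedOut (G : WGraph V) (F : Set (V × V)) (H : WGraph (G.clusterT F).Reach) : Prop :=
  H.m = G.redMassOut F ∧ H.a = G.redWeightOut F

/-- `γ⃗⁻_R`, for a reach `R` of the cluster graph: right kernel of `L⁻_Ẽ`. -/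
def vecIn (G : WGraph V) (F : Set (V × V)) (R : (G.restrict F).Reach) : V → ℝ :=
  (G.restrict F).harmonicVec R.1

/-- `γ⃖⁻_R`, for a reach `R` of the cluster graph: left kernel of `L⁻_Ẽ`. -/
def cevIn (G : WGraph V) (F : Set (V × V)) (R : (G.restrict F).Reach) : V → ℝ :=
  (G.restrict F).normalizedWeightVec R.1

/-- The node masses `m̲⁻` of the in-degree reduced graph. -/
def redMassIn (G : WGraph V) (F : Set (V × V)) (S : (G.restrict F).Reach) : ℝ :=
  projMass G.m (G.vecIn F) (G.cevIn F) S.1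

/-- The edge weights `a̲⁻` of the in-degree reduced graph. -/
def redWeightIn (G : WGraph V) (F : Set (V × V)) (R S : (G.restrict F).Reach) : ℝ :=
  G.redMassIn F R * ∑' r : R.1, ∑' s : S.1, G.cevIn F R r * G.a r s * G.vecIn F S s

/-- `H` is the reduced graph `G̲⁻`. -/
def IsReducedIn (G : WGraph V) (F : Set (V × V)) (H : WGraph (G.restrict F).Reach) : Prop :=
  H.m = G.redMassIn F ∧ H.a = G.redWeightIn F

/-- Isomorphism of weighted graphs. -/
def Isomorphic {W W' : Type*} (H : WGraph W) (H' : WGraph W') : Prop :=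
  ∃ e : W ≃ W', (∀ v, H'.m (e v) = H.m v) ∧ ∀ v w, H'.a (e v) (e w) = H.a v w

/-! ### Operators between `ℓ²(G)` and `ℓ²(G̲⁺)` -/

/-- `[J⁺↓ f](R) = ⟨γ⃖⁺_R, f⟩ / m̲⁺(R)`. -/
def IsProjOut (G : WGraph V) (F : Set (V × V)) (H : WGraph (G.clusterT F).Reach)
    (J : WeightedL2 G.m →L[ℂ] WeightedL2 H.m) : Prop :=
  ∀ (f : WeightedL2 G.m) (R : (G.clusterT F).Reach),
    J f R = (∑' v, (G.cevOut F R v : ℂ) * f v * (G.m v : ℂ)) / (H.m R : ℂ)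

/-- `J⁺↑ f = ∑ R, m̲⁺(R) f(R) γ⃗⁺_R`. -/
def IsInterpOut (G : WGraph V) (F : Set (V × V)) (H : WGraph (G.clusterT F).Reach)
    (J : WeightedL2 H.m →L[ℂ] WeightedL2 G.m) : Prop :=
  ∀ (f : WeightedL2 H.m) (v : V),
    J f v = ∑' R : (G.clusterT F).Reach, (H.m R : ℂ) * f R * (G.vecOut F R v : ℂ)

end WGraph

/-- `P` is the Riesz projection of `B` for the point `0`, which is not an accumulation point of
the spectrum of `B`. -/
def IsRieszProjAtZero {X : Type*} [NormedAddCommGroup X] [NormedSpace ℂ X]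
    (B P : X →L[ℂ] X) : Prop :=
  ∃ ε : ℝ, 0 < ε ∧ spectrum ℂ B ∩ Metric.closedBall 0 ε ⊆ {0} ∧
    P = (2 * Real.pi * Complex.I : ℂ)⁻¹ • ∮ z in C(0, ε), resolvent B z

end

noncomputable section

/-! ### Weighted `ℓ²` spaces and the Schur test. -/

namespace WeightedL2

open MeasureTheory

universe u w
variable {V : Type u} {W : Type w}

/-! For large `β` the term `β B`, with `B` the Laplacian of the clusters, forces functions into the
kernel of `B`, and only the compression of the remaining Laplacian `A` to that kernel survives.

The operator-theoretic half needs `Jd Ju = 1`, `B Ju = 0`, `Jd B = 0` and the invertibility of `B +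
P`, where `P = Ju Jd`. Then `(z - B)⁻¹ = z⁻¹ P + (z - (B + P))⁻¹ (1 - P)`, whose second term is
holomorphic near `0`, so `P` is the Riesz projection (`isRieszProjAtZero_of_isUnit`). If moreover `L
= Jd A Ju`, then `Ju (L - z)⁻¹ Jd` plus a correction of order `1 / β` inverts `A - z + β B` up to an
error `O(1 / β)`, which a Neumann series removes (`exists_norm_inverse_add_smul_sub_le`).

The graph-theoretic half supplies these relations. Up to masses, the out-degree Laplacian of the
cluster graph is the transpose of the in-degree Laplacian of the transposed cluster graph `T`.
Harmonic vectors of `T` therefore give the left kernel of `B` and weight vectors its right kernel.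
The former rests on the maximum principle (`harmonicVec_harmonic`), the latter on the Markov chain
tree theorem (`weightVec_balance`). A weight vector `w_S` lives on the roots of `S`, where `h_R` is
`1` if `R = S` and `0` otherwise; this biorthogonality is `Jd Ju = 1`. It also makes the matrix
entries of `Jd A Ju` those of the reduced Laplacian (`tsum_downKernel_lapOut_upKernel`).

Invertibility of `B + P` reduces to a finite matrix, since `B + P` is the identity away from the
finitely many endpoints of cluster edges; the maximum principle excludes a left kernel
(`isUnit_add_comp`). All operators are bounded by the Schur test. The two reduced graphs differ for
a fork: it has one reach, its transpose has two. -/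

theorem lintegral_massMeasure (m : V → ℝ) (f : V → ENNReal) :
    @lintegral V ⊤ (massMeasure m) f = ∑' v, ENNReal.ofReal (m v) * f v := by
  let _ : MeasurableSpace V := ⊤
  unfold massMeasure
  rw [lintegral_sum_measure]
  simp only [lintegral_smul_measure, lintegral_dirac, smul_eq_mul]

theorem massMeasure_singleton (m : V → ℝ) (v : V) :
    (@massMeasure V m) {v} = ENNReal.ofReal (m v) := by
  let _ : MeasurableSpace V := ⊤
  have h := lintegral_massMeasure m (Set.indicator {v} 1)
  rw [lintegral_indicator_one (MeasurableSpace.measurableSet_top)] at h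
  rw [h, tsum_eq_single v]
  · simp
  · intro b hb
    simp [hb]

/-- Every vertex is an atom of positive mass, so the only null set is empty. This turns the
almost-everywhere identities of `Lp` into pointwise ones. -/
theorem forall_of_ae {m : V → ℝ} (hm : ∀ v, 0 < m v) {p : V → Prop}
    (h : ∀ᵐ v ∂(massMeasure m), p v) (v : V) : p v := by
  by_contra hv
  have h0 : (massMeasure m) {v} = 0 :=
    measure_mono_null (by intro x hx; simp only [Set.mem_singleton_iff] at hx; subst hx; exact hv) h
  rw [massMeasure_singleton, ENNReal.ofReal_eq_zero] at h0
  exact absurd (hm v) (not_lt.mpr h0)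

variable {m : V → ℝ}

theorem ext {f g : WeightedL2 m} (h : ∀ v, f v = g v) : f = g :=
  Lp.ext (ae_of_all _ h)

theorem add_apply (hm : ∀ v, 0 < m v) (f g : WeightedL2 m) (v : V) : (f + g) v = f v + g v :=
  forall_of_ae hm (Lp.coeFn_add f g) v

theorem smul_apply (hm : ∀ v, 0 < m v) (c : ℂ) (f : WeightedL2 m) (v : V) :
    (c • f) v = c * f v :=
  forall_of_ae hm (Lp.coeFn_smul c f) v

theorem zero_apply (hm : ∀ v, 0 < m v) (v : V) : (0 : WeightedL2 m) v = 0 :=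
  forall_of_ae hm (Lp.coeFn_zero (E := ℂ) 2 (massMeasure m)) v

theorem stronglyMeasurable (f : V → ℂ) : @StronglyMeasurable V ℂ _ ⊤ f := by
  let _ : MeasurableSpace V := ⊤
  exact (measurable_from_top).stronglyMeasurable

theorem eLpNorm_sq (m : V → ℝ) (f : V → ℂ) :
    (eLpNorm f 2 (massMeasure m)) ^ 2 = ∑' v, ENNReal.ofReal (m v) * ‖f v‖ₑ ^ 2 := by
  let _ : MeasurableSpace V := ⊤
  rw [eLpNorm_eq_lintegral_rpow_enorm_toReal (by norm_num) (by norm_num), lintegral_massMeasure]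
  rw [← ENNReal.rpow_natCast, ← ENNReal.rpow_mul]
  norm_num

/-- The indicator function of a vertex. -/
def delta (m : V → ℝ) (v : V) : WeightedL2 m :=
  indicatorConstLp (μ := massMeasure m) 2 (s := {v}) MeasurableSpace.measurableSet_top
    (by rw [massMeasure_singleton]; exact ENNReal.ofReal_ne_top) 1

open Classical in
theorem delta_apply (hm : ∀ v, 0 < m v) (u v : V) :
    delta m u v = if v = u then 1 else 0 := by
  have := forall_of_ae hm (indicatorConstLp_coeFn (μ := massMeasure m) (p := 2) (s := {u})
    (hs := MeasurableSpace.measurableSet_top)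
    (hμs := by rw [massMeasure_singleton]; exact ENNReal.ofReal_ne_top) (c := (1 : ℂ))) v
  rw [delta, this, Set.indicator_apply]
  simp

theorem inner_delta (hm : ∀ v, 0 < m v) (f : WeightedL2 m) (v : V) :
    inner ℂ (delta m v) f = m v * f v := by
  let _ : MeasurableSpace V := ⊤
  rw [delta, L2.inner_indicatorConstLp_one, integral_singleton, Measure.real,
    massMeasure_singleton, ENNReal.toReal_ofReal (hm v).le, Complex.real_smul]

theorem dense_span_delta (hm : ∀ v, 0 < m v) :
    Dense (Submodule.span ℂ (Set.range (delta m)) : Set (WeightedL2 m)) := by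
  rw [Submodule.dense_iff_topologicalClosure_eq_top, Submodule.topologicalClosure_eq_top_iff,
    Submodule.eq_bot_iff]
  intro f hf
  refine ext fun v => ?_
  have h := (Submodule.mem_orthogonal _ f).1 hf (delta m v) (Submodule.subset_span ⟨v, rfl⟩)
  rw [inner_delta hm, mul_eq_zero] at h
  rw [zero_apply hm]
  exact h.resolve_left (by exact_mod_cast (hm v).ne')

/-- Bounded operators are determined by their matrix entries. -/
theorem clm_ext {m' : W → ℝ} (hm : ∀ v, 0 < m v)
    {S T : WeightedL2 m →L[ℂ] WeightedL2 m'}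
    (h : ∀ u w, S (delta m u) w = T (delta m u) w) : S = T := by
  refine ContinuousLinearMap.ext_on (dense_span_delta hm) ?_
  rintro _ ⟨u, rfl⟩
  exact ext (h u)

/-- A kernel that is locally finite and satisfies the two bounds of the Schur test. -/
structure SchurKernel (m : V → ℝ) (m' : W → ℝ) (k : W → V → ℝ) : Prop where
  finite_row : ∀ w, {v | k w v ≠ 0}.Finite
  finite_col : ∀ v, {w | k w v ≠ 0}.Finite
  bound : ∃ C : ℝ, 0 ≤ C ∧ (∀ w, ∑' v, |k w v| ≤ C) ∧ ∀ v, ∑' w, |k w v| * m' w ≤ C * m v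

theorem summable_of_finite {ι E : Type*} [AddCommMonoid E] [TopologicalSpace E] {f : ι → E}
    {s : Set ι} (hs : s.Finite) (h : ∀ x, x ∉ s → f x = 0) : Summable f :=
  summable_of_hasFiniteSupport (hs.subset fun x hx => by
    by_contra hxs
    exact hx (h x hxs))

theorem tsum_eq_sum_of_finite {ι E : Type*} [AddCommMonoid E] [TopologicalSpace E] [T2Space E]
    {f : ι → E} {s : Set ι} (hs : s.Finite) (h : ∀ x, x ∉ s → f x = 0) :
    ∑' x, f x = ∑ x ∈ hs.toFinset, f x :=
  tsum_eq_sum fun x hx => h x (by simpa using hx)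

/-- Cauchy–Schwarz with the weights `|k v|`, one factor of which is the row sum. -/
theorem row_bound {k : V → ℝ} (hk : {v | k v ≠ 0}.Finite) {C : ℝ}
    (hC : ∑' v, |k v| ≤ C) (f : V → ℂ) :
    ‖∑' v, (k v : ℂ) * f v‖ ^ 2 ≤ C * ∑' v, |k v| * ‖f v‖ ^ 2 := by
  rw [tsum_eq_sum_of_finite hk (by intro v hv; simp at hv; simp [hv])] at hC
  rw [tsum_eq_sum_of_finite hk (by intro v hv; simp at hv; simp [hv]),
    tsum_eq_sum_of_finite hk (by intro v hv; simp at hv; simp [hv])]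
  have h1 : ‖∑ v ∈ hk.toFinset, (k v : ℂ) * f v‖ ≤ ∑ v ∈ hk.toFinset, |k v| * ‖f v‖ := by
    refine (norm_sum_le _ _).trans (le_of_eq ?_)
    simp
  calc _ ≤ (∑ v ∈ hk.toFinset, |k v| * ‖f v‖) ^ 2 := by gcongr
    _ ≤ (∑ v ∈ hk.toFinset, |k v|) * ∑ v ∈ hk.toFinset, |k v| * ‖f v‖ ^ 2 :=
        Finset.sum_sq_le_sum_mul_sum_of_sq_le_mul _ (fun _ _ => abs_nonneg _)
          (fun _ _ => by positivity) (fun v _ => le_of_eq (by ring))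
    _ ≤ _ := by
        refine mul_le_mul_of_nonneg_right hC (Finset.sum_nonneg fun _ _ => by positivity)

/-- The row bound gives one factor `C` pointwise. After Tonelli the column bound gives the second
factor and exchanges `m'` for `m`. Working in `ENNReal` makes the interchange unconditional. -/
theorem schur_estimate {m' : W → ℝ} (hm' : ∀ v, 0 < m' v)
    {k : W → V → ℝ} (hrow : ∀ w, {v | k w v ≠ 0}.Finite) (hcol : ∀ v, {w | k w v ≠ 0}.Finite)
    {C : ℝ} (hC : 0 ≤ C) (hr : ∀ w, ∑' v, |k w v| ≤ C)
    (hc : ∀ v, ∑' w, |k w v| * m' w ≤ C * m v) (f : V → ℂ) :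
    eLpNorm (fun w => ∑' v, (k w v : ℂ) * f v) 2 (massMeasure m') ≤
      ENNReal.ofReal C * eLpNorm f 2 (massMeasure m) := by
  rw [← ENNReal.pow_le_pow_left_iff (n := 2) (by norm_num), mul_pow, eLpNorm_sq, eLpNorm_sq]
  have hpt : ∀ w, ENNReal.ofReal (m' w) * ‖∑' v, (k w v : ℂ) * f v‖ₑ ^ 2 ≤
      ENNReal.ofReal C * ∑' v, ENNReal.ofReal (|k w v| * m' w) * ‖f v‖ₑ ^ 2 := by
    intro w
    have h := row_bound (hrow w) (hr w) f
    have h2 := ENNReal.ofReal_le_ofReal h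
    rw [ENNReal.ofReal_pow (norm_nonneg _), ofReal_norm, ENNReal.ofReal_mul hC,
      ENNReal.ofReal_tsum_of_nonneg (fun _ => by positivity)
        (summable_of_finite (hrow w) (by intro v hv; simp at hv; simp [hv]))] at h2
    calc _ ≤ ENNReal.ofReal (m' w) * _ := mul_le_mul_right h2 _
      _ = _ := by
        rw [mul_left_comm, ← ENNReal.tsum_mul_left]
        congr 2
        ext v
        rw [ENNReal.ofReal_mul (abs_nonneg _), ENNReal.ofReal_mul (abs_nonneg _),
          ENNReal.ofReal_pow (norm_nonneg _), ofReal_norm]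
        ring
  calc _ ≤ ∑' w, ENNReal.ofReal C * ∑' v, ENNReal.ofReal (|k w v| * m' w) * ‖f v‖ₑ ^ 2 :=
        ENNReal.tsum_le_tsum hpt
    _ = ENNReal.ofReal C * ∑' v, (∑' w, ENNReal.ofReal (|k w v| * m' w)) * ‖f v‖ₑ ^ 2 := by
        rw [ENNReal.tsum_mul_left, ENNReal.tsum_comm]
        simp_rw [ENNReal.tsum_mul_right]
    _ ≤ ENNReal.ofReal C * ∑' v, (ENNReal.ofReal C * ENNReal.ofReal (m v)) * ‖f v‖ₑ ^ 2 := by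
        gcongr with v
        rw [← ENNReal.ofReal_tsum_of_nonneg (fun w => mul_nonneg (abs_nonneg _) (hm' w).le)
          (summable_of_finite (hcol v) (by intro w hw; simp at hw; simp [hw])),
          ← ENNReal.ofReal_mul hC]
        exact ENNReal.ofReal_le_ofReal (hc v)
    _ = _ := by
        simp_rw [mul_assoc]
        rw [ENNReal.tsum_mul_left, sq, mul_assoc]

/-- The Schur test. -/
theorem SchurKernel.exists_clm (hm : ∀ v, 0 < m v) {m' : W → ℝ} (hm' : ∀ v, 0 < m' v)
    {k : W → V → ℝ} (hk : SchurKernel m m' k) :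
    ∃ T : WeightedL2 m →L[ℂ] WeightedL2 m', ∀ f w, T f w = ∑' v, (k w v : ℂ) * f v := by
  obtain ⟨C, hC, hr, hc⟩ := hk.bound
  have est := schur_estimate (m := m) hm' hk.finite_row hk.finite_col hC hr hc
  have mem : ∀ f : WeightedL2 m,
      MemLp (fun w => ∑' v, (k w v : ℂ) * f v) 2 (massMeasure m') := fun f =>
    ⟨(stronglyMeasurable _).aestronglyMeasurable,
      (est f).trans_lt (ENNReal.mul_lt_top ENNReal.ofReal_lt_top (Lp.memLp f).2)⟩
  have app : ∀ (f : WeightedL2 m) w, (mem f).toLp _ w = ∑' v, (k w v : ℂ) * f v := fun f w =>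
    forall_of_ae hm' (mem f).coeFn_toLp w
  have sm : ∀ (f : V → ℂ) w, Summable fun v => (k w v : ℂ) * f v := fun f w =>
    summable_of_finite (hk.finite_row w) (by intro v hv; simp at hv; simp [hv])
  refine ⟨LinearMap.mkContinuous
    { toFun := fun f => (mem f).toLp _
      map_add' := fun f g => ext fun w => ?_
      map_smul' := fun c f => ext fun w => ?_ } C fun f => ?_, fun f w => app f w⟩
  · rw [add_apply hm', app, app, app, ← (sm _ w).tsum_add (sm _ w)]
    simp only [add_apply hm, mul_add]
  · rw [RingHom.id_apply, smul_apply hm', app, app, ← tsum_mul_left]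
    simp only [smul_apply hm]
    exact tsum_congr fun v => by ring
  · change ‖(mem f).toLp _‖ ≤ _
    rw [Lp.norm_toLp, Lp.norm_def]
    have := ENNReal.toReal_mono (ENNReal.mul_ne_top ENNReal.ofReal_ne_top (Lp.memLp f).2.ne) (est f)
    rwa [ENNReal.toReal_mul, ENNReal.toReal_ofReal hC] at this

theorem tsum_mul_delta (hm : ∀ v, 0 < m v) (k : V → ℂ) (u : V) :
    ∑' v, k v * delta m u v = k u := by
  classical
  rw [tsum_eq_single u]
  · simp [delta_apply hm]
  · intro v hv
    simp [delta_apply hm, hv]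

end WeightedL2

/-! ### Strong coupling in a Banach algebra. -/

section Perturbation

variable {𝔸 : Type*} [NormedRing 𝔸] [CompleteSpace 𝔸]

/-- The inverse `w` satisfies `w = 1 - x * w`, whence `‖w‖ ≤ ‖1‖ + ‖w‖ / 2`. The factor `‖1‖` stays
because the algebra need not have a unit of norm one; it may be trivial. -/
theorem isUnit_one_add_of_norm_le_half {x : 𝔸} (hx : ‖x‖ ≤ 1 / 2) :
    IsUnit (1 + x) ∧ ‖Ring.inverse (1 + x)‖ ≤ 2 * ‖(1 : 𝔸)‖ := by
  have hu : IsUnit (1 + x) := by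
    have := isUnit_one_sub_of_norm_lt_one (x := -x) (by rw [norm_neg]; linarith)
    rwa [sub_neg_eq_add] at this
  refine ⟨hu, ?_⟩
  have h := Ring.mul_inverse_cancel _ hu
  set w := Ring.inverse (1 + x)
  have hw : w = 1 - x * w := by rw [← h]; noncomm_ring
  have h1 : ‖w‖ ≤ ‖(1 : 𝔸)‖ + ‖x‖ * ‖w‖ := by
    calc ‖w‖ = ‖1 - x * w‖ := by rw [← hw]
      _ ≤ ‖(1 : 𝔸)‖ + ‖x * w‖ := norm_sub_le _ _
      _ ≤ _ := by gcongr; exact norm_mul_le _ _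
  nlinarith [norm_nonneg w]

variable [NormedAlgebra ℂ 𝔸]

/-- Strong coupling limit: if `S` inverts `B` on a complement of the range of the spectral
projection `P` for the point `0`, and `R` inverts the compression of `D` to the range of `P`,
then `(D + β B)⁻¹ = R + O(1 / β)`. -/
theorem exists_norm_inverse_add_smul_sub_le {D B P S R : 𝔸}
    (hSB : S * B = 1 - P) (hBS : B * S = 1 - P)
    (hBR : B * R = 0) (hRB : R * B = 0)
    (hPDR : P * D * R = P) (hRDP : R * D * P = P) :
    ∃ C : ℝ, 0 < C ∧ ∃ β₀ : ℝ, 0 < β₀ ∧ ∀ β : ℝ, β₀ ≤ β →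
      IsUnit (D + (β : ℂ) • B) ∧ ‖Ring.inverse (D + (β : ℂ) • B) - R‖ ≤ C / β := by
  set Y := S * (1 - D * R) with hY
  set Y' := (1 - R * D) * S with hY'
  set E := D * Y with hE
  set E' := Y' * D with hE'
  set K := ‖Y - R * E‖ * (2 * ‖(1 : 𝔸)‖) with hK
  have hK0 : 0 ≤ K := by positivity
  -- The choice of `β₀` makes both errors `β⁻¹ E` and `β⁻¹ E'` at most `1 / 2` in norm. The added
  -- ones only secure positivity.
  refine ⟨K + 1, by linarith, 2 * ‖E‖ + 2 * ‖E'‖ + 1, by positivity, fun β hβ => ?_⟩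
  have hβ0 : 0 < β := lt_of_lt_of_le (by positivity) hβ
  have hβc : (β : ℂ) ≠ 0 := by exact_mod_cast hβ0.ne'
  have hinv : ‖((β : ℂ)⁻¹)‖ = β⁻¹ := by
    rw [norm_inv, Complex.norm_real, Real.norm_of_nonneg hβ0.le]
  have small : ∀ x : 𝔸, 2 * ‖x‖ ≤ β → ‖(β : ℂ)⁻¹ • x‖ ≤ 1 / 2 := by
    intro x hx
    rw [norm_smul, hinv, inv_mul_le_iff₀ hβ0]
    linarith
  obtain ⟨hu, hn⟩ := isUnit_one_add_of_norm_le_half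
    (small E (by linarith [norm_nonneg E, norm_nonneg E']))
  obtain ⟨hu', -⟩ := isUnit_one_add_of_norm_le_half
    (small E' (by linarith [norm_nonneg E, norm_nonneg E']))
  have hBY : B * Y = 1 - D * R := by
    have : B * Y = (1 - P) * (1 - D * R) := by rw [hY, ← mul_assoc, hBS]
    rw [this]
    have h2 : (1 - P) * (1 - D * R) = 1 - D * R - P + P * D * R := by noncomm_ring
    rw [h2, hPDR]; abel
  have hYB : Y' * B = 1 - R * D := by
    have : Y' * B = (1 - R * D) * (1 - P) := by rw [hY', mul_assoc, hSB]
    rw [this]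
    have h2 : (1 - R * D) * (1 - P) = 1 - R * D - P + R * D * P := by noncomm_ring
    rw [h2, hRDP]; abel
  have hright : (D + (β : ℂ) • B) * (R + (β : ℂ)⁻¹ • Y) = 1 + (β : ℂ)⁻¹ • E := by
    rw [add_mul, mul_add, mul_add, smul_mul_assoc, smul_mul_assoc, hBR, mul_smul_comm,
      mul_smul_comm, smul_smul, mul_inv_cancel₀ hβc, hBY, hE]
    simp only [smul_zero, one_smul]
    abel
  have hleft : (R + (β : ℂ)⁻¹ • Y') * (D + (β : ℂ) • B) = 1 + (β : ℂ)⁻¹ • E' := by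
    rw [mul_add, add_mul, add_mul, mul_smul_comm, mul_smul_comm, hRB, smul_mul_assoc,
      smul_mul_assoc, smul_smul, mul_inv_cancel₀ hβc, hYB, hE']
    simp only [smul_zero, one_smul]
    abel
  set T := D + (β : ℂ) • B with hT
  have hTu : IsUnit T := by
    refine isUnit_iff_exists_and_exists.2
      ⟨⟨(R + (β : ℂ)⁻¹ • Y) * Ring.inverse (1 + (β : ℂ)⁻¹ • E), ?_⟩,
        ⟨Ring.inverse (1 + (β : ℂ)⁻¹ • E') * (R + (β : ℂ)⁻¹ • Y'), ?_⟩⟩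
    · rw [← mul_assoc, hright, Ring.mul_inverse_cancel _ hu]
    · rw [mul_assoc, hleft, Ring.inverse_mul_cancel _ hu']
  refine ⟨hTu, ?_⟩
  set W := Ring.inverse (1 + (β : ℂ)⁻¹ • E)
  have hTW : Ring.inverse T = (R + (β : ℂ)⁻¹ • Y) * W := by
    have h : T * ((R + (β : ℂ)⁻¹ • Y) * W) = 1 := by
      rw [← mul_assoc, hright, Ring.mul_inverse_cancel _ hu]
    calc Ring.inverse T = Ring.inverse T * (T * ((R + (β : ℂ)⁻¹ • Y) * W)) := by rw [h, mul_one]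
      _ = _ := by rw [← mul_assoc, Ring.inverse_mul_cancel _ hTu, one_mul]
  -- Writing `R` with the same right factor `W` as the inverse leaves a difference proportional to
  -- `β⁻¹`.
  have hRW : R = (R * (1 + (β : ℂ)⁻¹ • E)) * W := by
    rw [mul_assoc, Ring.mul_inverse_cancel _ hu, mul_one]
  have hdiff : Ring.inverse T - R = ((β : ℂ)⁻¹ • (Y - R * E)) * W := by
    rw [hTW]
    nth_rewrite 2 [hRW]
    rw [← sub_mul]
    congr 1
    rw [mul_add, mul_one, mul_smul_comm, smul_sub]
    abel
  rw [hdiff]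
  calc _ ≤ ‖(β : ℂ)⁻¹ • (Y - R * E)‖ * ‖W‖ := norm_mul_le _ _
    _ ≤ (β⁻¹ * ‖Y - R * E‖) * (2 * ‖(1 : 𝔸)‖) := by
        rw [norm_smul, hinv]
        gcongr
    _ = K / β := by rw [hK]; field_simp
    _ ≤ (K + 1) / β := by gcongr; linarith

end Perturbation

/-! ### Riesz projections. -/

section Riesz

open Metric

variable {X : Type*} [NormedAddCommGroup X] [NormedSpace ℂ X] [CompleteSpace X]

/-- A projection annihilated by `B` on both sides such that `B + P` is invertible is the Riesz
projection of `B` for the point `0`. -/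
theorem isRieszProjAtZero_of_isUnit {B P : X →L[ℂ] X} (hPP : P * P = P) (hBP : B * P = 0)
    (hPB : P * B = 0) (hu : IsUnit (B + P)) : IsRieszProjAtZero B P := by
  have h0 : (0 : ℂ) ∈ resolventSet ℂ (B + P) := by
    rw [spectrum.mem_resolventSet_iff, map_zero, zero_sub]
    exact hu.neg
  obtain ⟨ε, hε, hball⟩ := Metric.nhds_basis_closedBall.mem_iff.1
    ((spectrum.isOpen_resolventSet (B + P)).mem_nhds h0)
  -- On the range of `P` the operator `B` vanishes and on the range of `1 - P` it agrees with `B +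
  -- P`, whose resolvent exists on the whole closed disc.
  have key : ∀ z ∈ closedBall (0 : ℂ) ε, z ≠ 0 →
      IsUnit (algebraMap ℂ (X →L[ℂ] X) z - B) ∧
      resolvent B z = z⁻¹ • P + resolvent (B + P) z * (1 - P) := by
    intro z hz hz0
    have hz' := spectrum.mem_resolventSet_iff.1 (hball hz)
    set N := resolvent (B + P) z with hN
    have h1 : (algebraMap ℂ (X →L[ℂ] X) z - (B + P)) * N = 1 := Ring.mul_inverse_cancel _ hz'
    have h2 : N * (algebraMap ℂ (X →L[ℂ] X) z - (B + P)) = 1 := Ring.inverse_mul_cancel _ hz'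
    have comm : P * (algebraMap ℂ (X →L[ℂ] X) z - (B + P)) =
        (algebraMap ℂ (X →L[ℂ] X) z - (B + P)) * P := by
      simp only [mul_sub, sub_mul, mul_add, add_mul, hPB, hBP, Algebra.commutes]
    have commN : P * N = N * P := by
      calc P * N = N * (algebraMap ℂ (X →L[ℂ] X) z - (B + P)) * (P * N) := by rw [h2, one_mul]
        _ = N * (P * (algebraMap ℂ (X →L[ℂ] X) z - (B + P))) * N := by
            rw [comm]; simp only [mul_assoc]
        _ = N * P := by rw [mul_assoc, mul_assoc, h1, mul_one]
    have hzP : algebraMap ℂ (X →L[ℂ] X) z * (z⁻¹ • P) = P := by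
      rw [← Algebra.smul_def, smul_smul, mul_inv_cancel₀ hz0, one_smul]
    have hPP' : P * (1 - P) = 0 := by rw [mul_sub, mul_one, hPP, sub_self]
    have hP'P : (1 - P) * P = 0 := by rw [sub_mul, one_mul, hPP, sub_self]
    have hr : (algebraMap ℂ (X →L[ℂ] X) z - B) * (z⁻¹ • P + N * (1 - P)) = 1 := by
      have e : algebraMap ℂ (X →L[ℂ] X) z - B = (algebraMap ℂ (X →L[ℂ] X) z - (B + P)) + P := by
        abel
      have e2 : (algebraMap ℂ (X →L[ℂ] X) z - B) * (N * (1 - P)) = 1 - P := by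
        rw [e, add_mul, ← mul_assoc, h1, one_mul, ← mul_assoc, commN, mul_assoc, hPP', mul_zero,
          add_zero]
      rw [mul_add, e2, sub_mul, hzP, mul_smul_comm, hBP, smul_zero]
      abel
    have hl : (z⁻¹ • P + N * (1 - P)) * (algebraMap ℂ (X →L[ℂ] X) z - B) = 1 := by
      have e : algebraMap ℂ (X →L[ℂ] X) z - B = (algebraMap ℂ (X →L[ℂ] X) z - (B + P)) + P := by
        abel
      have c1 : (1 - P) * (algebraMap ℂ (X →L[ℂ] X) z - B) =
          (algebraMap ℂ (X →L[ℂ] X) z - (B + P)) * (1 - P) := by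
        rw [e, mul_add, hP'P, add_zero, sub_mul, one_mul, comm, mul_sub, mul_one]
      have e2 : (N * (1 - P)) * (algebraMap ℂ (X →L[ℂ] X) z - B) = 1 - P := by
        rw [mul_assoc, c1, ← mul_assoc, h2, one_mul]
      have e3 : (z⁻¹ • P) * algebraMap ℂ (X →L[ℂ] X) z = P := by
        rw [← Algebra.commutes, hzP]
      rw [add_mul, e2, mul_sub, e3, smul_mul_assoc, hPB, smul_zero]
      abel
    have hunit : IsUnit (algebraMap ℂ (X →L[ℂ] X) z - B) := ⟨⟨_, _, hr, hl⟩, rfl⟩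
    refine ⟨hunit, ?_⟩
    calc resolvent B z = resolvent B z *
          ((algebraMap ℂ (X →L[ℂ] X) z - B) * (z⁻¹ • P + N * (1 - P))) := by rw [hr, mul_one]
      _ = _ := by
        rw [← mul_assoc, resolvent, Ring.inverse_mul_cancel _ hunit, one_mul]
  refine ⟨ε, hε, ?_, ?_⟩
  · rintro z ⟨hz, hzb⟩
    by_contra hne
    exact hz (key z hzb hne).1
  -- By Cauchy's theorem the regular term integrates to zero; the term `z⁻¹ • P` contributes `2πi
  -- P`.
  · have hcl : ∀ z ∈ closedBall (0 : ℂ) ε,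
        DifferentiableAt ℂ (fun z => resolvent (B + P) z * (1 - P)) z := fun z hz =>
      (spectrum.hasDerivAt_resolvent_const_left (hball hz)).differentiableAt.mul_const _
    have hd : DiffContOnCl ℂ (fun z => resolvent (B + P) z * (1 - P)) (ball (0 : ℂ) ε) := by
      refine ⟨fun z hz => (hcl z (ball_subset_closedBall hz)).differentiableWithinAt, ?_⟩
      rw [closure_ball _ hε.ne']
      exact fun z hz => (hcl z hz).continuousAt.continuousWithinAt
    have hI := hd.circleIntegral_eq_zero hε.le
    have hsph : ∀ z ∈ sphere (0 : ℂ) ε, z ≠ 0 := fun z hz h => by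
      rw [h, mem_sphere, dist_self] at hz
      exact hε.ne hz
    rw [circleIntegral.integral_congr hε.le (g := fun z => z⁻¹ • P +
      resolvent (B + P) z * (1 - P)) fun z hz => (key z (sphere_subset_closedBall hz) (hsph z hz)).2]
    rw [circleIntegral.integral_add, hI, add_zero, circleIntegral.integral_smul_const]
    · have := circleIntegral.integral_sub_inv_of_mem_ball (c := 0) (w := 0) (R := ε)
        (mem_ball_self hε)
      simp only [sub_zero] at this
      rw [this, smul_smul, inv_mul_cancel₀ Complex.two_pi_I_ne_zero, one_smul]
    · refine ContinuousOn.circleIntegrable hε.le ?_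
      exact (continuousOn_id.inv₀ hsph).smul continuousOn_const
    · refine ContinuousOn.circleIntegrable hε.le fun z hz =>
        (hcl z (sphere_subset_closedBall hz)).continuousAt.continuousWithinAt

end Riesz

namespace WGraph

open WeightedL2

universe u
variable {V : Type u} (T : WGraph V)

/-! ### Combinatorics of reaches and their roots. -/

section Reaches

variable {T}

theorem sees_trans {F : Set (V × V)} {i j k : V} (h : Sees F i j) (h' : Sees F j k) :
    Sees F i k := Relation.ReflTransGen.trans h h'

theorem finite_setOf_sees_left (hE : T.edges.Finite) (i : V) : {j | Sees T.edges j i}.Finite := by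
  refine ((hE.image Prod.fst).insert i).subset fun j hj => ?_
  rcases Relation.ReflTransGen.cases_head hj with h | ⟨b, hb, -⟩
  · exact Or.inl h
  · exact Or.inr ⟨_, hb, rfl⟩

theorem finite_setOf_sees_right (hE : T.edges.Finite) (i : V) : {j | Sees T.edges i j}.Finite := by
  refine ((hE.image Prod.snd).insert i).subset fun j hj => ?_
  rcases Relation.ReflTransGen.cases_tail hj with h | ⟨b, -, hb⟩
  · exact Or.inl h
  · exact Or.inr ⟨_, hb, rfl⟩

theorem mem_reachableSet_self (i : V) : i ∈ T.reachableSet i := Relation.ReflTransGen.refl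

theorem reachableSet_subset {i j : V} (h : Sees T.edges i j) :
    T.reachableSet i ⊆ T.reachableSet j := fun _ hk => sees_trans hk h

/-- Take a maximal set among the finitely many reachable sets of vertices seen by `v`. It is maximal
among all reachable sets, since any larger one contains `j` and so belongs to a vertex that `v` sees
too. -/
theorem exists_isReach_sees (hE : T.edges.Finite) (v : V) :
    ∃ j, T.IsReach (T.reachableSet j) ∧ Sees T.edges v j := by
  obtain ⟨S, hS⟩ := ((finite_setOf_sees_right hE v).image T.reachableSet).exists_maximal
    ⟨_, v, Relation.ReflTransGen.refl, rfl⟩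
  obtain ⟨j, hj, rfl⟩ := hS.1
  refine ⟨j, ⟨⟨j, rfl⟩, ?_⟩, hj⟩
  rintro _ ⟨k, rfl⟩ hle
  exact hS.2 ⟨k, sees_trans hj (hle (mem_reachableSet_self j)), rfl⟩ hle

theorem IsReach.exists_root {R : Set V} (hR : T.IsReach R) : ∃ i, R = T.reachableSet i := hR.1

theorem IsReach.eq_reachableSet {R : Set V} (hR : T.IsReach R) {j : V}
    (h : R ⊆ T.reachableSet j) : R = T.reachableSet j :=
  h.antisymm (hR.2 ⟨j, rfl⟩ h)

theorem IsReach.mem_of_sees {R : Set V} (hR : T.IsReach R) {x y : V} (hy : y ∈ R)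
    (h : Sees T.edges x y) : x ∈ R := by
  obtain ⟨i, rfl⟩ := hR.exists_root
  exact sees_trans h hy

/-- A root determines its reach: if `S` contains a root of `R`, then it contains `R`, and maximality
applies. -/
theorem IsReach.eq_of_mem {R S : Set V} (hR : T.IsReach R) (hS : T.IsReach S) {i : V}
    (hi : R = T.reachableSet i) (h : i ∈ S) : S = R := by
  obtain ⟨j, rfl⟩ := hS.exists_root
  subst hi
  exact (hR.eq_reachableSet (reachableSet_subset h)).symm

theorem IsReach.finite (hE : T.edges.Finite) {R : Set V} (hR : T.IsReach R) : R.Finite := by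
  obtain ⟨i, rfl⟩ := hR.exists_root
  exact finite_setOf_sees_left hE i

theorem root_mem_exclusivePart {i : V} (hR : T.IsReach (T.reachableSet i)) :
    i ∈ T.exclusivePart (T.reachableSet i) := by
  refine ⟨mem_reachableSet_self i, fun S hS hne w hw h => hne ?_⟩
  exact hR.eq_of_mem hS rfl (hS.mem_of_sees hw h)

theorem disjoint_exclusivePart_commonPart {R : Set V} {v : V} (h : v ∈ T.exclusivePart R) :
    v ∉ T.commonPart R := by
  rintro ⟨-, S, hS, hne, w, hw, hs⟩
  exact h.2 S hS hne w hw hs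

theorem mem_exclusivePart_or_mem_commonPart {R : Set V} {v : V} (h : v ∈ R) :
    v ∈ T.exclusivePart R ∨ v ∈ T.commonPart R := by
  by_cases hc : v ∈ T.commonPart R
  · exact Or.inr hc
  · refine Or.inl ⟨h, fun S hS hne w hw hs => hc ⟨h, S, hS, hne, w, hw, hs⟩⟩

/-- `y` sees a root and hence lies in some reach. Were `y` outside `R`, this would be another reach
seen from `x`. -/
theorem mem_exclusivePart_of_edge (hE : T.edges.Finite) {R : Set V} {x y : V}
    (hx : x ∈ T.exclusivePart R) (hxy : 0 < T.a x y) : y ∈ T.exclusivePart R := by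
  have hs : Sees T.edges x y := Relation.ReflTransGen.single hxy
  obtain ⟨j, hj, hyj⟩ := exists_isReach_sees hE y
  refine ⟨?_, fun S hS hne w hw h => hx.2 S hS hne w hw (sees_trans hs h)⟩
  by_contra hyR
  refine hx.2 _ hj ?_ y hyj hs
  rintro rfl
  exact hyR hyj

theorem finite_setOf_mem_reach (hE : T.edges.Finite) (v : V) :
    {R : T.Reach | v ∈ R.1}.Finite := by
  refine (((finite_setOf_sees_right hE v).image T.reachableSet).preimage
    Subtype.val_injective.injOn).subset fun R hR => ?_
  obtain ⟨i, hi⟩ := R.2.exists_root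
  refine ⟨i, ?_, hi.symm⟩
  have hR' : v ∈ R.1 := hR
  rw [hi] at hR'
  exact hR'

end Reaches

/-! ### The maximum principle on directed graphs. -/

section MaximumPrinciple

theorem tsum_a_mul (x : V) (u : V → ℝ) :
    ∑' y, T.a x y * u y = ∑ y ∈ (T.finite_in x).toFinset, T.a x y * u y :=
  tsum_eq_sum_of_finite _ fun y hy => by
    have : T.a x y = 0 := le_antisymm (not_lt.1 hy) (T.a_nonneg x y)
    rw [this, zero_mul]

theorem degIn_eq (x : V) : T.degIn x = ∑ y ∈ (T.finite_in x).toFinset, T.a x y := by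
  have := T.tsum_a_mul x 1
  simpa [degIn] using this

theorem a_eq_zero {x y : V} (h : ¬ 0 < T.a x y) : T.a x y = 0 :=
  le_antisymm (not_lt.1 h) (T.a_nonneg x y)

/-- At a vertex where the maximum `M` is attained, the nonnegative terms `a y w * (M - u w)` have a
sum at most zero, so all neighbours along edges attain `M`; this propagates along paths. -/
theorem eq_of_sees_of_subharmonic {u : V → ℝ} {M : ℝ} (hM : ∀ y, u y ≤ M)
    (hsub : ∀ x, u x = M → T.degIn x * u x ≤ ∑' y, T.a x y * u y) {x z : V} (hx : u x = M)
    (hs : Sees T.edges x z) : u z = M := by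
  induction hs with
  | refl => exact hx
  | @tail y z _ hyz ih =>
    have h := hsub y ih
    rw [tsum_a_mul, degIn_eq, ih, Finset.sum_mul] at h
    have h2 : ∑ w ∈ (T.finite_in y).toFinset, T.a y w * (M - u w) ≤ 0 := by
      simp only [mul_sub, Finset.sum_sub_distrib]
      linarith
    have hz : z ∈ (T.finite_in y).toFinset := by
      rw [Set.Finite.mem_toFinset]
      exact hyz
    have h3 := Finset.single_le_sum (f := fun w => T.a y w * (M - u w))
      (fun w _ => mul_nonneg (T.a_nonneg y w) (sub_nonneg.2 (hM w))) hz
    have h4 : T.a y z * (M - u z) ≤ 0 := h3.trans h2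
    have h5 : M - u z ≤ 0 := nonpos_of_mul_nonpos_right h4 hyz
    exact le_antisymm (hM z) (by linarith)

theorem exists_max_of_pos {u : V → ℝ} (hfin : {x | u x ≠ 0}.Finite) {x₀ : V} (h : 0 < u x₀) :
    ∃ x, 0 < u x ∧ ∀ y, u y ≤ u x := by
  obtain ⟨x, hx, hmax⟩ := hfin.exists_maximalFor u _ ⟨x₀, h.ne'⟩
  have hx0 : u x₀ ≤ u x := by
    by_contra hlt
    exact hlt (by have := hmax (j := x₀) h.ne' (not_le.1 hlt).le; exact this)
  refine ⟨x, h.trans_le hx0, fun y => ?_⟩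
  by_contra hlt
  have hy : u y ≠ 0 := by linarith [not_le.1 hlt]
  exact hlt (hmax hy (not_le.1 hlt).le)

/-- A function that is subharmonic where it is positive, and not positive at some vertex seen by
each vertex, is not positive anywhere. -/
theorem nonpos_of_subharmonic {u : V → ℝ} (hfin : {x | u x ≠ 0}.Finite)
    (hsub : ∀ x, 0 < u x → T.degIn x * u x ≤ ∑' y, T.a x y * u y)
    (hz : ∀ x, 0 < u x → ∃ z, u z ≤ 0 ∧ Sees T.edges x z) (x : V) : u x ≤ 0 := by
  by_contra hx
  obtain ⟨x, hx, hmax⟩ := exists_max_of_pos hfin (not_le.1 hx)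
  obtain ⟨z, hz0, hs⟩ := hz x hx
  have := T.eq_of_sees_of_subharmonic hmax (fun y hy => hsub y (hy ▸ hx)) rfl hs
  linarith

end MaximumPrinciple

/-! ### Harmonic vectors: kernel property, sign and partition of unity. -/

section Harmonic

theorem lapIn_mul_eq_zero {x y : V} (u : V → ℝ) (hy : y ∉ insert x {w | 0 < T.a x w}) :
    T.lapIn x y * u y = 0 := by
  have h1 : x ≠ y := fun h => hy (Or.inl h.symm)
  have h2 : T.a x y = 0 := T.a_eq_zero fun h => hy (Or.inr h)
  simp [lapIn, h1, h2]

theorem summable_lapIn_mul (x : V) (u : V → ℝ) : Summable fun y => T.lapIn x y * u y :=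
  summable_of_finite ((T.finite_in x).insert x) fun _ hy => T.lapIn_mul_eq_zero u hy

theorem tsum_lapIn_mul (x : V) (u : V → ℝ) :
    ∑' y, T.lapIn x y * u y = (T.degIn x * u x - ∑' y, T.a x y * u y) / T.m x := by
  classical
  have h1 : ∑' y, (if x = y then T.degIn x else 0) * u y = T.degIn x * u x := by
    rw [tsum_eq_single x (fun y hy => by simp [hy.symm])]
    simp
  rw [← h1, ← Summable.tsum_sub, ← tsum_div_const]
  · refine tsum_congr fun y => ?_
    rw [lapIn]
    ring
  · exact summable_of_finite (Set.finite_singleton x) fun y hy => by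
      rw [if_neg (fun h => hy h.symm), zero_mul]
  · exact summable_of_finite (T.finite_in x) fun y hy => by rw [T.a_eq_zero hy, zero_mul]

variable {T}

theorem harmonicVec_of_mem_exclusivePart {R : Set V} {v : V} (h : v ∈ T.exclusivePart R) :
    T.harmonicVec R v = 1 := by
  rw [harmonicVec, if_pos h]

theorem harmonicVec_of_notMem {R : Set V} {v : V} (h : v ∉ R) : T.harmonicVec R v = 0 := by
  rw [harmonicVec, if_neg (fun h' => h h'.1), dif_neg (fun h' => h h'.1.1)]

theorem IsReach.finite_commonPart (hE : T.edges.Finite) {R : Set V} (hR : T.IsReach R) :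
    (T.commonPart R).Finite := (hR.finite hE).subset fun _ h => h.1

open Classical in
theorem harmonicVec_of_mem_commonPart {R : Set V} [Fintype (T.commonPart R)]
    (v : T.commonPart R) :
    T.harmonicVec R v = (-((Matrix.of fun x y : T.commonPart R => T.lapIn x y)⁻¹ *ᵥ
      fun x : T.commonPart R => ∑' y : T.exclusivePart R, T.lapIn x y)) v := by
  rw [harmonicVec, if_neg (fun h => disjoint_exclusivePart_commonPart h v.2),
    dif_pos ⟨v.2, Set.toFinite _⟩]
  congr!

/-- The block of the in-degree Laplacian belonging to the common part is injective. -/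
theorem nonpos_of_lapIn_common_eq_zero (hE : T.edges.Finite) {R : Set V} (hR : T.IsReach R)
    {u : V → ℝ} (hu : ∀ x, x ∉ T.commonPart R → u x = 0)
    (hharm : ∀ x ∈ T.commonPart R, ∑' y, T.lapIn x y * u y = 0) (x : V) : u x ≤ 0 := by
  have mem : ∀ x, 0 < u x → x ∈ T.commonPart R := fun x hx => by
    by_contra h
    exact hx.ne' (hu x h)
  refine T.nonpos_of_subharmonic ((hR.finite_commonPart hE).subset fun x hx => ?_) (fun x hx => ?_)
    (fun x hx => ?_) x
  · by_contra h
    exact hx (hu x h)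
  · have := hharm x (mem x hx)
    rw [tsum_lapIn_mul, div_eq_zero_iff] at this
    have := this.resolve_right (T.m_pos x).ne'
    linarith
  -- Every vertex of the reach sees the root, which is exclusive, so that `u` vanishes there.
  · obtain ⟨i, rfl⟩ := hR.exists_root
    refine ⟨i, (hu i ?_).le, (mem x hx).1⟩
    exact disjoint_exclusivePart_commonPart (root_mem_exclusivePart hR)

open Classical in
-- A kernel vector of the block, extended by zero, obeys the maximum principle with either sign and
-- must vanish.
theorem isUnit_det_lapIn_common (hE : T.edges.Finite) {R : Set V} (hR : T.IsReach R)
    [Fintype (T.commonPart R)] :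
    IsUnit (Matrix.of fun x y : T.commonPart R => T.lapIn x y).det := by
  rw [isUnit_iff_ne_zero]
  intro h
  obtain ⟨v, hv, hv0⟩ := Matrix.exists_mulVec_eq_zero_iff.2 h
  apply hv
  set u : V → ℝ := fun x => if h : x ∈ T.commonPart R then v ⟨x, h⟩ else 0 with hu
  have hu0 : ∀ x, x ∉ T.commonPart R → u x = 0 := fun x hx => by simp [hu, hx]
  have hu1 : ∀ x : T.commonPart R, u x = v x := fun x => by simp [hu]
  have hharm : ∀ x ∈ T.commonPart R, ∑' y, T.lapIn x y * u y = 0 := fun x hx => by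
    rw [← tsum_subtype_eq_of_support_subset (s := T.commonPart R), tsum_fintype]
    · have := congrFun hv0 ⟨x, hx⟩
      simp only [Matrix.mulVec, dotProduct, Matrix.of_apply, Pi.zero_apply] at this
      simpa only [hu1] using this
    · intro y hy
      by_contra hyc
      exact hy (by simp [hu0 y hyc])
  have h1 := nonpos_of_lapIn_common_eq_zero hE hR hu0 hharm
  have h2 := nonpos_of_lapIn_common_eq_zero hE hR (u := -u) (fun x hx => by simp [hu0 x hx])
    (fun x hx => by simp [hharm x hx, tsum_neg])
  ext x
  rw [← hu1]
  exact le_antisymm (h1 x) (by simpa using h2 x)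

/-- The harmonic vector lies in the kernel of the in-degree Laplacian. -/
theorem harmonicVec_harmonic (hE : T.edges.Finite) {R : Set V} (hR : T.IsReach R) (x : V) :
    ∑' y, T.a x y * T.harmonicVec R y = T.degIn x * T.harmonicVec R x := by
  classical
  by_cases hxR : x ∈ R
  · rcases mem_exclusivePart_or_mem_commonPart (T := T) hxR with hx | hx
    · rw [harmonicVec_of_mem_exclusivePart hx, mul_one, degIn]
      refine tsum_congr fun y => ?_
      by_cases hxy : 0 < T.a x y
      · rw [harmonicVec_of_mem_exclusivePart (mem_exclusivePart_of_edge hE hx hxy), mul_one]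
      · rw [T.a_eq_zero hxy, zero_mul]
    · have : Fintype (T.commonPart R) := (hR.finite_commonPart hE).fintype
      -- The row of the Laplacian splits into its blocks over the common part and the exclusive
      -- part, where the vector is `1`. The defining linear system says that the two cancel.
      have hsplit : ∀ y, T.lapIn x y * T.harmonicVec R y =
          (T.commonPart R).indicator (fun y => T.lapIn x y * T.harmonicVec R y) y +
          (T.exclusivePart R).indicator (fun y => T.lapIn x y) y := by
        intro y
        by_cases hy : y ∈ R
        · rcases mem_exclusivePart_or_mem_commonPart (T := T) hy with h | h
          · rw [Set.indicator_of_notMem (disjoint_exclusivePart_commonPart h),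
              Set.indicator_of_mem h, harmonicVec_of_mem_exclusivePart h, mul_one, zero_add]
          · rw [Set.indicator_of_mem h, Set.indicator_of_notMem
              (fun h' => disjoint_exclusivePart_commonPart h' h), add_zero]
        · rw [Set.indicator_of_notMem (fun h => hy h.1), Set.indicator_of_notMem (fun h => hy h.1),
            harmonicVec_of_notMem hy, mul_zero, add_zero]
      have hs1 : Summable ((T.commonPart R).indicator
          fun y => T.lapIn x y * T.harmonicVec R y) :=
        (T.summable_lapIn_mul x _).indicator _
      have hs2 : Summable ((T.exclusivePart R).indicator fun y => T.lapIn x y) := by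
        have := T.summable_lapIn_mul x 1
        simp only [Pi.one_apply, mul_one] at this
        exact this.indicator _
      have key : ∑' y, T.lapIn x y * T.harmonicVec R y = 0 := by
        rw [tsum_congr hsplit, hs1.tsum_add hs2, ← tsum_subtype, ← tsum_subtype, tsum_fintype]
        have hinv := isUnit_det_lapIn_common hE hR
        set A := (Matrix.of fun x y : T.commonPart R => T.lapIn x y) with hA
        set b := fun x : T.commonPart R => ∑' y : T.exclusivePart R, T.lapIn x y with hb
        have h1 : A *ᵥ (fun y => T.harmonicVec R y) = -b := by
          have : (fun y : T.commonPart R => T.harmonicVec R y) = -(A⁻¹ *ᵥ b) := by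
            ext y
            rw [harmonicVec_of_mem_commonPart y]
          rw [this, Matrix.mulVec_neg, Matrix.mulVec_mulVec, Matrix.mul_nonsing_inv _ hinv,
            Matrix.one_mulVec]
        have h2 := congrFun h1 ⟨x, hx⟩
        simp only [Matrix.mulVec, dotProduct, hA, Matrix.of_apply, hb, Pi.neg_apply] at h2
        rw [h2, neg_add_cancel]
      rw [tsum_lapIn_mul, div_eq_zero_iff] at key
      have := key.resolve_right (T.m_pos x).ne'
      linarith
  -- A vertex outside `R` has no edge from a vertex of `R`, as it would then see the root of `R`.
  · rw [harmonicVec_of_notMem hxR, mul_zero, ← tsum_zero (α := ℝ) (β := V)]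
    refine tsum_congr fun y => ?_
    by_cases hxy : 0 < T.a x y
    · rw [harmonicVec_of_notMem, mul_zero]
      exact fun hy => hxR (hR.mem_of_sees hy (Relation.ReflTransGen.single hxy))
    · rw [T.a_eq_zero hxy, zero_mul]

/-- The maximum principle for the negated vector, which is `-1` at the root of the reach. -/
theorem harmonicVec_nonneg (hE : T.edges.Finite) {R : Set V} (hR : T.IsReach R) (x : V) :
    0 ≤ T.harmonicVec R x := by
  have h : ∀ x, 0 < -T.harmonicVec R x → x ∈ R := fun x hx => by
    by_contra hxR
    rw [harmonicVec_of_notMem hxR] at hx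
    simp at hx
  have := T.nonpos_of_subharmonic (u := fun x => -T.harmonicVec R x)
    ((hR.finite hE).subset fun x hx => ?_) (fun x _ => ?_) (fun x hx => ?_) x
  · linarith
  · by_contra hxR
    exact hx (by simp [harmonicVec_of_notMem hxR])
  · simp only [mul_neg, tsum_neg]
    rw [harmonicVec_harmonic hE hR]
  · obtain ⟨i, rfl⟩ := hR.exists_root
    refine ⟨i, ?_, h x hx⟩
    rw [harmonicVec_of_mem_exclusivePart (root_mem_exclusivePart hR)]
    norm_num

open Classical in
-- A root of `S` is exclusive in `S` and belongs to no other reach. This is the source of all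
-- biorthogonality relations.
theorem harmonicVec_root {R S : Set V} (hR : T.IsReach R) (hS : T.IsReach S) {i : V}
    (hi : S = T.reachableSet i) : T.harmonicVec R i = if R = S then 1 else 0 := by
  split_ifs with h
  · subst h
    subst hi
    exact harmonicVec_of_mem_exclusivePart (root_mem_exclusivePart hR)
  · refine harmonicVec_of_notMem fun hiR => h (hS.eq_of_mem hR hi hiR)

theorem harmonicVec_finite (hE : T.edges.Finite) {R : Set V} (hR : T.IsReach R) :
    {v | T.harmonicVec R v ≠ 0}.Finite :=
  (hR.finite hE).subset fun v hv => by
    by_contra h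
    exact hv (harmonicVec_of_notMem h)

theorem harmonicVec_finite_reach (hE : T.edges.Finite) (v : V) :
    {R : T.Reach | T.harmonicVec R.1 v ≠ 0}.Finite :=
  (finite_setOf_mem_reach hE v).subset fun R hR => by
    by_contra h
    exact hR (harmonicVec_of_notMem h)

theorem tsum_harmonicVec_root {i : V} (hi : T.IsReach (T.reachableSet i)) :
    ∑' R : T.Reach, T.harmonicVec R.1 i = 1 := by
  classical
  rw [tsum_eq_single ⟨_, hi⟩]
  · rw [harmonicVec_root hi hi rfl, if_pos rfl]
  · intro R hR
    rw [harmonicVec_root R.2 hi rfl, if_neg fun h => hR (Subtype.ext h)]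

/-- The harmonic vectors form a partition of unity. -/
theorem tsum_harmonicVec (hE : T.edges.Finite) (v : V) :
    ∑' R : T.Reach, T.harmonicVec R.1 v = 1 := by
  set g := fun v => ∑' R : T.Reach, T.harmonicVec R.1 v with hg
  have hsum : ∀ v, Summable fun R : T.Reach => T.harmonicVec R.1 v := fun v =>
    summable_of_finite (harmonicVec_finite_reach hE v) fun R hR => by simpa using hR
  have hharm : ∀ x, ∑' y, T.a x y * g y = T.degIn x * g x := by
    intro x
    rw [tsum_a_mul]
    simp only [hg, ← tsum_mul_left]
    rw [← Summable.tsum_finsetSum fun y _ => (hsum y).mul_left _]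
    refine tsum_congr fun R => ?_
    rw [← tsum_a_mul, harmonicVec_harmonic hE R.2]
  -- Constants are harmonic for the in-degree Laplacian, so `1 - g` is harmonic; it vanishes at all
  -- roots, and the maximum principle applies with both signs.
  have hone : ∀ x, ∑' y, T.a x y * (1 - g y) = T.degIn x * (1 - g x) := by
    intro x
    have h := hharm x
    rw [tsum_a_mul] at h ⊢
    simp only [mul_sub, Finset.sum_sub_distrib, h, mul_one, ← degIn_eq]
  -- A vertex at which no edge terminates is a root itself, so only the finitely many terminal
  -- vertices of edges can contribute.
  have hfin : {x | 1 - g x ≠ 0}.Finite := by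
    refine (hE.image Prod.fst).subset fun x hx => ?_
    obtain ⟨j, hj, hxj⟩ := exists_isReach_sees hE x
    rcases Relation.ReflTransGen.cases_head hxj with rfl | ⟨b, hb, -⟩
    · exact absurd (by simp [hg, tsum_harmonicVec_root hj]) hx
    · exact ⟨_, hb, rfl⟩
  have hroot : ∀ x, ∃ z, 1 - g z = 0 ∧ Sees T.edges x z := fun x => by
    obtain ⟨j, hj, hxj⟩ := exists_isReach_sees hE x
    exact ⟨j, by simp [hg, tsum_harmonicVec_root hj], hxj⟩
  have h1 := T.nonpos_of_subharmonic hfin (fun x _ => (hone x).ge)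
    (fun x _ => (hroot x).imp fun z hz => ⟨hz.1.le, hz.2⟩) v
  have h2 := T.nonpos_of_subharmonic (u := fun x => -(1 - g x)) (by simpa only [ne_eq, neg_eq_zero] using hfin)
    (fun x _ => by simp only [mul_neg, tsum_neg, hone]; rfl)
    (fun x _ => (hroot x).imp fun z hz => ⟨by simp [hz.1], hz.2⟩) v
  change g v = 1
  linarith

end Harmonic

end WGraph

/-! ### The Markov chain tree theorem for parent functions. -/

section TreeFormula

variable {ι : Type*}

/-- Every point reaches `y` under iteration of `p`. -/
def IterReaches (p : ι → ι) (y : ι) : Prop := ∀ v, ∃ n, p^[n] v = y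

theorem IterReaches.of_apply {p : ι → ι} {x : ι} (h : IterReaches p x) : IterReaches p (p x) :=
  fun v => (h v).elim fun n hn => ⟨n + 1, by rw [Function.iterate_succ_apply', hn]⟩

theorem IterReaches.mem_periodicPts {p : ι → ι} {x : ι} (h : IterReaches p x) :
    x ∈ Function.periodicPts p := by
  obtain ⟨n, hn⟩ := h (p x)
  refine ⟨n + 1, Nat.succ_pos n, ?_⟩
  rw [Function.IsPeriodicPt, Function.IsFixedPt, Function.iterate_succ_apply, hn]

/-- The points reached by everything form the single cycle of `p`, and `p` permutes its periodic
points; `x` is the predecessor of `y` on the cycle. -/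
theorem IterReaches.existsUnique {p : ι → ι} {y : ι} (h : IterReaches p y) :
    ∃! x, IterReaches p x ∧ p x = y := by
  have hb := Function.bijOn_periodicPts p
  obtain ⟨n, hn⟩ := h (p y)
  have hx : p (p^[n] y) = y := by
    rw [← Function.iterate_succ_apply' p, Function.iterate_succ_apply, hn]
  refine ⟨p^[n] y, ⟨fun v => ?_, hx⟩, fun x' hx' => ?_⟩
  · obtain ⟨k, hk⟩ := h v
    exact ⟨n + k, by rw [Function.iterate_add_apply, hk]⟩
  · refine hb.2.1 hx'.1.mem_periodicPts ?_ (hx'.2.trans hx.symm)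
    refine IterReaches.mem_periodicPts (p := p) fun v => ?_
    obtain ⟨k, hk⟩ := h v
    exact ⟨n + k, by rw [Function.iterate_add_apply, hk]⟩

open Classical in
/-- Sums over rooted spanning trees with one additional edge at the root balance. -/
theorem sum_iterReaches_balance [Fintype ι] (a : ι → ι → ℝ) (y : ι) :
    ∑ z, ∑ p : ι → ι with IterReaches p y ∧ p y = z, ∏ v, a v (p v) =
      ∑ x, ∑ p : ι → ι with IterReaches p x ∧ p x = y, ∏ v, a v (p v) := by
  simp only [Finset.sum_filter]
  rw [Finset.sum_comm, Finset.sum_comm (s := Finset.univ (α := ι)) (t := Finset.univ)]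
  refine Finset.sum_congr rfl fun p _ => ?_
  -- Each `p` whose cycle contains `y` is counted once on either side: by the successor `z = p y` on
  -- the left, by the predecessor `x` on the right.
  by_cases h : IterReaches p y
  · obtain ⟨x, hx, hu⟩ := h.existsUnique
    rw [Finset.sum_eq_single (p y) (fun z _ hz => if_neg fun h' : _ ∧ _ => hz h'.2.symm) (by simp),
      Finset.sum_eq_single x (fun z _ hz => if_neg fun h' : _ ∧ _ => hz (hu z h')) (by simp),
      if_pos ⟨h, rfl⟩, if_pos hx]
  · rw [Finset.sum_eq_zero fun z _ => if_neg fun h' : _ ∧ _ => h h'.1,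
      Finset.sum_eq_zero fun z _ => if_neg fun h' : IterReaches p _ ∧ p _ = y => h (h'.2 ▸ h'.1.of_apply)]

end TreeFormula

/-! ### Weight vectors of reaches. -/

namespace WGraph

open WeightedL2

universe u
variable {V : Type u} {T : WGraph V}

open Classical in
-- A rooted spanning tree is the same as a parent function with positive weights off the root. The
-- value at the root is not determined by the tree, and fixing it as `z` makes the correspondence
-- bijective. Functions that use a non-edge contribute zero.
theorem weightVec_eq_sum {R : Set V} [Fintype R] (x z : R) :
    T.weightVec R x = ∑ p : R → R with IterReaches p x ∧ p x = z,
      ∏ v ∈ Finset.univ.erase x, T.a (v : R) (p v) := by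
  set s : Set (R → R) := {p | (IterReaches p x ∧ p x = z) ∧ ∀ v : R, v ≠ x → 0 < T.a v (p v)}
  set e : (R → R) → Finset (V × V) := fun p =>
    (Finset.univ.erase x).image fun v : R => ((v : V), (p v : V)) with he
  have mem_e : ∀ (p : R → R) (u y : V), (u, y) ∈ e p ↔ ∃ v : R, v ≠ x ∧ (v : V) = u ∧
      (p v : V) = y := by
    intro p u y
    simp [he]
  have maps : Set.MapsTo e s {F | T.IsSpanningTree R x F} := by
    rintro p ⟨⟨hp, hz⟩, hpos⟩
    refine ⟨x.2, ?_, ?_, ?_, ?_⟩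
    · rintro ⟨u, y⟩ h
      obtain ⟨v, hv, rfl, rfl⟩ := (mem_e _ _ _).1 h
      exact ⟨hpos v hv, v.2, (p v).2⟩
    · intro y h
      obtain ⟨v, hv, hvx, -⟩ := (mem_e _ _ _).1 h
      exact hv (Subtype.ext hvx)
    · intro u hu hne
      refine ⟨p ⟨u, hu⟩, (mem_e _ _ _).2 ⟨⟨u, hu⟩, fun h => hne (congrArg Subtype.val h), rfl, rfl⟩,
        fun y hy => ?_⟩
      obtain ⟨v, hv, rfl, rfl⟩ := (mem_e _ _ _).1 hy
      rfl
    · intro u hu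
      obtain ⟨n, hn⟩ := hp ⟨u, hu⟩
      have : ∀ n (v : R), p^[n] v = x → Sees (e p : Set (V × V)) v x := by
        intro n
        induction n with
        | zero => rintro v rfl; exact Relation.ReflTransGen.refl
        | succ n ih =>
          intro v hv
          by_cases hvx : v = x
          · rw [hvx]; exact Relation.ReflTransGen.refl
          · exact Relation.ReflTransGen.head ((mem_e _ _ _).2 ⟨v, hvx, rfl, rfl⟩) (ih (p v) hv)
      exact this n _ hn
  have inj : Set.InjOn e s := by
    rintro p ⟨⟨-, hz⟩, -⟩ p' ⟨⟨-, hz'⟩, -⟩ hpp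
    ext v
    by_cases hv : v = x
    · rw [hv, hz, hz']
    · have h : ((v : V), (p v : V)) ∈ e p := (mem_e _ _ _).2 ⟨v, hv, rfl, rfl⟩
      rw [hpp] at h
      obtain ⟨w, -, hw, hw'⟩ := (mem_e _ _ _).1 h
      rw [← hw', Subtype.ext hw]
  have surj : Set.SurjOn e s {F | T.IsSpanningTree R x F} := by
    intro F hF
    have hex : ∀ v : R, ∃ y : R, (v = x → y = z) ∧ (v ≠ x → ((v : V), (y : V)) ∈ F) := by
      intro v
      by_cases hv : v = x
      · exact ⟨z, fun _ => rfl, fun h => absurd hv h⟩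
      · obtain ⟨y, hy, -⟩ := hF.unique_in v v.2 (fun h => hv (Subtype.ext h))
        exact ⟨⟨y, (hF.edge_mem _ hy).2.2⟩, fun h => absurd h hv, fun _ => hy⟩
    choose p hp1 hp2 using hex
    have huniq : ∀ (v : R) (y : V), ((v : V), y) ∈ F → v ≠ x ∧ (p v : V) = y := by
      intro v y hy
      have hv : v ≠ x := by rintro rfl; exact hF.root_in _ hy
      refine ⟨hv, (hF.unique_in v v.2 (fun h => hv (Subtype.ext h))).unique (hp2 v hv) hy⟩
    refine ⟨p, ⟨⟨fun v => ?_, hp1 x rfl⟩, fun v hv => (hF.edge_mem _ (hp2 v hv)).1⟩, ?_⟩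
    · have hs := hF.connected v v.2
      have : ∀ u, Sees (F : Set (V × V)) u x → ∀ hu : u ∈ R, ∃ n, p^[n] ⟨u, hu⟩ = x := by
        intro u hu
        induction hu using Relation.ReflTransGen.head_induction_on with
        | refl => exact fun _ => ⟨0, rfl⟩
        | @head c b hcb _ ih =>
          intro hc
          obtain ⟨n, hn⟩ := ih (hF.edge_mem _ hcb).2.2
          refine ⟨n + 1, ?_⟩
          rw [Function.iterate_succ_apply, ← hn]
          congr 1
          exact Subtype.ext (huniq ⟨c, hc⟩ b hcb).2
      exact this v hs v.2
    · ext ⟨u, y⟩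
      rw [mem_e]
      constructor
      · rintro ⟨v, hv, rfl, rfl⟩
        exact hp2 v hv
      · intro h
        obtain ⟨h1, h2⟩ := huniq ⟨u, (hF.edge_mem _ h).2.1⟩ y h
        exact ⟨_, h1, rfl, h2⟩
  have hval : ∀ p ∈ s, ∏ v ∈ Finset.univ.erase x, T.a (v : R) (p v) = ∏ f ∈ e p, T.a f.1 f.2 := by
    intro p _
    rw [he, Finset.prod_image]
    intro v _ w _ h
    exact Subtype.ext (congrArg Prod.fst h)
  have h1 : T.weightVec R x = ∑ᶠ F ∈ {F | T.IsSpanningTree R x F}, ∏ f ∈ F, T.a f.1 f.2 := rfl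
  rw [h1, ← finsum_mem_eq_of_bijOn e ⟨maps, inj, surj⟩ hval,
    finsum_mem_eq_finite_toFinset_sum _ (Set.toFinite s)]
  refine Finset.sum_subset (fun p hp => ?_) fun p hp hps => ?_
  · rw [Set.Finite.mem_toFinset] at hp
    simpa using hp.1
  · rw [Set.Finite.mem_toFinset] at hps
    have hp' : IterReaches p x ∧ p x = z := by simpa using hp
    have : ∃ v, v ≠ x ∧ ¬ 0 < T.a v (p v) := by
      by_contra! hall
      exact hps ⟨hp', hall⟩
    obtain ⟨v, hv, h0⟩ := this
    exact Finset.prod_eq_zero (Finset.mem_erase.2 ⟨hv, Finset.mem_univ v⟩) (T.a_eq_zero h0)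

theorem weightVec_nonneg (R : Set V) (i : V) : 0 ≤ T.weightVec R i :=
  finsum_nonneg fun _ => finsum_nonneg fun _ => Finset.prod_nonneg fun _ _ => T.a_nonneg _ _

theorem exists_isSpanningTree_of_weightVec_ne_zero {R : Set V} {i : V} (h : T.weightVec R i ≠ 0) :
    ∃ F, T.IsSpanningTree R i F := by
  obtain ⟨F, hF, -⟩ := exists_ne_zero_of_finsum_mem_ne_zero (s := {F | T.IsSpanningTree R i F}) h
  exact ⟨F, hF⟩

/-- A nonzero weight yields a spanning tree rooted at `i`, so `i` reaches all of `R`. -/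
theorem IsReach.eq_of_weightVec_ne_zero {R : Set V} (hR : T.IsReach R) {i : V}
    (h : T.weightVec R i ≠ 0) : R = T.reachableSet i := by
  obtain ⟨F, hF⟩ := exists_isSpanningTree_of_weightVec_ne_zero h
  exact hR.eq_reachableSet fun x hx =>
    Relation.ReflTransGen.mono (fun _ _ h => (hF.edge_mem _ h).1) _ _ (hF.connected x hx)

theorem mem_of_weightVec_ne_zero {R : Set V} {i : V} (h : T.weightVec R i ≠ 0) : i ∈ R :=
  (exists_isSpanningTree_of_weightVec_ne_zero h).elim fun _ hF => hF.root_mem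

open Classical in
-- Multiplying the weight at `x` by `a x z` closes each tree by an edge at its root, which turns
-- tree sums into the sums of `sum_iterReaches_balance`.
theorem weightVec_balance_of_mem {R : Set V} [Fintype R] (y : R) :
    T.weightVec R y * ∑ z : R, T.a y z = ∑ x : R, T.weightVec R x * T.a x y := by
  have h := sum_iterReaches_balance (fun v w : R => T.a v w) y
  have key : ∀ x z : R, T.weightVec R x * T.a x z =
      ∑ p : R → R with IterReaches p x ∧ p x = z, ∏ v : R, T.a v (p v) := by
    intro x z
    rw [weightVec_eq_sum x z, Finset.sum_mul]
    refine Finset.sum_congr rfl fun p hp => ?_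
    have hp' : IterReaches p x ∧ p x = z := by simpa using hp
    rw [← Finset.prod_erase_mul _ _ (Finset.mem_univ x), hp'.2]
  rw [Finset.mul_sum]
  simp only [key]
  convert h

/-- The weight vector lies in the left kernel of the in-degree Laplacian. -/
theorem weightVec_balance (hE : T.edges.Finite) {R : Set V} (hR : T.IsReach R) (y : V) :
    ∑' x, T.weightVec R x * T.a x y = T.weightVec R y * T.degIn y := by
  by_cases hy : y ∈ R
  · have : Fintype R := (hR.finite hE).fintype
    have hb := weightVec_balance_of_mem (T := T) ⟨y, hy⟩
    rw [← tsum_subtype_eq_of_support_subset (s := R), tsum_fintype, ← hb]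
    · by_cases hw : T.weightVec R y = 0
      · simp [hw]
      -- Since `y` is a root, every `z` with an edge to `y` reaches all of `R` and hence lies in `R`
      -- by maximality. So the full in-degree equals the one inside `R`.
      · have hroot := hR.eq_of_weightVec_ne_zero hw
        rw [degIn, ← tsum_subtype_eq_of_support_subset (s := R), tsum_fintype]
        intro z hz
        have hz' : 0 < T.a y z := by
          by_contra h
          exact hz (T.a_eq_zero h)
        have hsub : R ⊆ T.reachableSet z := by
          conv_lhs => rw [hroot]
          exact reachableSet_subset (Relation.ReflTransGen.single hz')
        rw [hR.eq_reachableSet hsub]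
        exact mem_reachableSet_self z
    · intro x hx
      exact mem_of_weightVec_ne_zero (left_ne_zero_of_mul hx)
  · have hw : T.weightVec R y = 0 := by
      by_contra h
      exact hy (mem_of_weightVec_ne_zero h)
    rw [hw, zero_mul, ← tsum_zero (α := ℝ) (β := V)]
    refine tsum_congr fun x => ?_
    by_contra h
    obtain ⟨h1, h2⟩ := mul_ne_zero_iff.1 h
    have hpos : 0 < T.a x y := by
      by_contra h0
      exact h2 (T.a_eq_zero h0)
    have hsub : R ⊆ T.reachableSet y := by
      conv_lhs => rw [hR.eq_of_weightVec_ne_zero h1]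
      exact reachableSet_subset (Relation.ReflTransGen.single hpos)
    rw [hR.eq_reachableSet hsub] at hy
    exact hy (mem_reachableSet_self y)

/-- A breadth-first tree: `D n` consists of the vertices joined to the root by a path of length `n`,
and the parent of a vertex has a smaller least such `n`. -/
theorem exists_iterReaches (i : V) :
    ∃ p : T.reachableSet i → T.reachableSet i,
      IterReaches p ⟨i, mem_reachableSet_self i⟩ ∧ p ⟨i, mem_reachableSet_self i⟩ =
        ⟨i, mem_reachableSet_self i⟩ ∧ ∀ v : T.reachableSet i, v ≠ ⟨i, mem_reachableSet_self i⟩ →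
        0 < T.a v (p v) := by
  classical
  set D : ℕ → Set V := fun n => (fun S => {x | ∃ y ∈ S, (x, y) ∈ T.edges})^[n] {i} with hD
  have hsucc : ∀ n, D (n + 1) = {x | ∃ y ∈ D n, (x, y) ∈ T.edges} := fun n => by
    rw [hD]
    simp only [Function.iterate_succ_apply']
  have hex : ∀ v, Sees T.edges v i → ∃ n, v ∈ D n := by
    intro v hv
    refine Relation.ReflTransGen.head_induction_on hv ⟨0, rfl⟩ fun {c b} hcb _ ih => ?_
    obtain ⟨n, hn⟩ := ih
    exact ⟨n + 1, by rw [hsucc]; exact ⟨b, hn, hcb⟩⟩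
  have hback : ∀ n v, v ∈ D n → v ∈ T.reachableSet i := by
    intro n
    induction n with
    | zero => intro v hv; rw [show v = i from hv]; exact mem_reachableSet_self i
    | succ n ih =>
      intro v hv
      rw [hsucc] at hv
      obtain ⟨y, hy, hvy⟩ := hv
      exact Relation.ReflTransGen.head hvy (ih y hy)
  set i' : T.reachableSet i := ⟨i, mem_reachableSet_self i⟩
  have hpar : ∀ v : T.reachableSet i, ∃ y : T.reachableSet i, (v = i' → y = i') ∧
      (v ≠ i' → 0 < T.a v y ∧ Nat.find (hex y y.2) < Nat.find (hex v v.2)) := by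
    intro v
    by_cases hv : v = i'
    · exact ⟨i', fun _ => rfl, fun h => absurd hv h⟩
    · have hmem := Nat.find_spec (hex v v.2)
      obtain ⟨n, hn⟩ : ∃ n, Nat.find (hex v v.2) = n + 1 := by
        refine Nat.exists_eq_succ_of_ne_zero fun h0 => hv (Subtype.ext ?_)
        rw [h0] at hmem
        exact hmem
      rw [hn, hsucc] at hmem
      obtain ⟨y, hy, hvy⟩ := hmem
      refine ⟨⟨y, hback n y hy⟩, fun h => absurd h hv, fun _ => ⟨hvy, ?_⟩⟩
      rw [hn]
      exact Nat.lt_succ_of_le (Nat.find_le hy)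
  choose p hp1 hp2 using hpar
  refine ⟨p, ?_, hp1 i' rfl, fun v hv => (hp2 v hv).1⟩
  have : ∀ n (v : T.reachableSet i), Nat.find (hex v v.2) = n → ∃ k, p^[k] v = i' := by
    intro n
    induction n using Nat.strong_induction_on with
    | _ n ih =>
      intro v hv
      by_cases h : v = i'
      · exact ⟨0, h⟩
      · obtain ⟨k, hk⟩ := ih _ (hv ▸ (hp2 v h).2) (p v) rfl
        exact ⟨k + 1, hk⟩
  exact fun v => this _ v rfl

theorem weightVec_root_pos (hE : T.edges.Finite) {i : V} (hR : T.IsReach (T.reachableSet i)) :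
    0 < T.weightVec (T.reachableSet i) i := by
  classical
  have : Fintype (T.reachableSet i) := (hR.finite hE).fintype
  obtain ⟨p, hp, hpi, hpos⟩ := exists_iterReaches (T := T) i
  rw [weightVec_eq_sum (R := T.reachableSet i) ⟨i, mem_reachableSet_self i⟩
    ⟨i, mem_reachableSet_self i⟩]
  refine Finset.sum_pos' (fun q _ => Finset.prod_nonneg fun _ _ => T.a_nonneg _ _) ⟨p, ?_, ?_⟩
  · simpa using ⟨hp, hpi⟩
  · exact Finset.prod_pos fun v hv => hpos v (Finset.ne_of_mem_erase hv)

theorem IsReach.tsum_mul_weightVec_pos (hE : T.edges.Finite) {R : Set V} (hR : T.IsReach R) :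
    0 < ∑' j, T.m j * T.weightVec R j := by
  obtain ⟨i, rfl⟩ := hR.exists_root
  refine Summable.tsum_pos (summable_of_finite (hR.finite hE) fun x hx => ?_)
    (fun j => mul_nonneg (T.m_pos j).le (weightVec_nonneg _ _)) i
    (mul_pos (T.m_pos i) (weightVec_root_pos hE hR))
  by_contra h
  exact hx (mem_of_weightVec_ne_zero (right_ne_zero_of_mul h))

theorem normalizedWeightVec_nonneg (hE : T.edges.Finite) {R : Set V} (hR : T.IsReach R) (i : V) :
    0 ≤ T.normalizedWeightVec R i :=
  div_nonneg (weightVec_nonneg _ _) (hR.tsum_mul_weightVec_pos hE).le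

theorem weightVec_ne_zero_of_normalized {R : Set V} {i : V} (h : T.normalizedWeightVec R i ≠ 0) :
    T.weightVec R i ≠ 0 := fun h0 => h (by rw [normalizedWeightVec, h0, zero_div])

theorem tsum_mul_normalizedWeightVec (hE : T.edges.Finite) {R : Set V} (hR : T.IsReach R) :
    ∑' j, T.m j * T.normalizedWeightVec R j = 1 := by
  simp only [normalizedWeightVec, ← mul_div_assoc]
  rw [tsum_div_const, div_self (hR.tsum_mul_weightVec_pos hE).ne']

theorem normalizedWeightVec_balance (hE : T.edges.Finite) {R : Set V} (hR : T.IsReach R) (y : V) :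
    ∑' x, T.normalizedWeightVec R x * T.a x y = T.normalizedWeightVec R y * T.degIn y := by
  simp only [normalizedWeightVec, div_mul_eq_mul_div]
  rw [tsum_div_const, weightVec_balance hE hR]

open Classical in
theorem harmonicVec_of_normalizedWeightVec_ne_zero {R S : Set V} (hR : T.IsReach R)
    (hS : T.IsReach S) {i : V} (h : T.normalizedWeightVec S i ≠ 0) :
    T.harmonicVec R i = if R = S then 1 else 0 :=
  harmonicVec_root hR hS (hS.eq_of_weightVec_ne_zero (weightVec_ne_zero_of_normalized h))

end WGraph

/-! ### From the intertwining relations to norm resolvent convergence. -/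

section Reduction

variable {X Y : Type*} [NormedAddCommGroup X] [NormedSpace ℂ X] [CompleteSpace X]
  [NormedAddCommGroup Y] [NormedSpace ℂ Y]

theorem isRieszProjAtZero_comp {B : X →L[ℂ] X} {Jd : X →L[ℂ] Y} {Ju : Y →L[ℂ] X}
    (hJ : Jd ∘L Ju = 1) (hBJ : B ∘L Ju = 0) (hJB : Jd ∘L B = 0)
    (hu : IsUnit (B + Ju ∘L Jd)) : IsRieszProjAtZero B (Ju ∘L Jd) := by
  refine isRieszProjAtZero_of_isUnit ?_ ?_ ?_ hu
  · change (Ju ∘L Jd) ∘L (Ju ∘L Jd) = _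
    rw [ContinuousLinearMap.comp_assoc, ← ContinuousLinearMap.comp_assoc Jd, hJ]
    rfl
  · change B ∘L (Ju ∘L Jd) = _
    rw [← ContinuousLinearMap.comp_assoc, hBJ, ContinuousLinearMap.zero_comp]
  · change (Ju ∘L Jd) ∘L B = _
    rw [ContinuousLinearMap.comp_assoc, hJB, ContinuousLinearMap.comp_zero]

/-- Norm resolvent convergence of `A + β B` to the compression of `A` to the range of the spectral
projection `Ju ∘ Jd` of `B` for the point `0`, with rate `1 / β`. -/
theorem exists_norm_resolvent_sub_le {A B : X →L[ℂ] X} {L : Y →L[ℂ] Y} {Jd : X →L[ℂ] Y}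
    {Ju : Y →L[ℂ] X} (hJ : Jd ∘L Ju = 1) (hBJ : B ∘L Ju = 0) (hJB : Jd ∘L B = 0)
    (hL : L = Jd ∘L A ∘L Ju) (hu : IsUnit (B + Ju ∘L Jd)) {z : ℂ} (hz : z ∈ resolventSet ℂ L) :
    ∃ C : ℝ, 0 < C ∧ ∃ β₀ : ℝ, 0 < β₀ ∧ ∀ β : ℝ, β₀ ≤ β →
      z ∈ resolventSet ℂ (A + (β : ℂ) • B) ∧
      ‖Ring.inverse (A + (β : ℂ) • B - algebraMap ℂ _ z) -
        Ju ∘L Ring.inverse (L - algebraMap ℂ _ z) ∘L Jd‖ ≤ C / β := by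
  set P : X →L[ℂ] X := Ju ∘L Jd with hP
  have hPP : P * P = P := by
    change (Ju ∘L Jd) ∘L (Ju ∘L Jd) = _
    rw [ContinuousLinearMap.comp_assoc, ← ContinuousLinearMap.comp_assoc Jd, hJ]
    rfl
  have hBP : B * P = 0 := by
    change B ∘L (Ju ∘L Jd) = _
    rw [← ContinuousLinearMap.comp_assoc, hBJ, ContinuousLinearMap.zero_comp]
  have hPB : P * B = 0 := by
    change (Ju ∘L Jd) ∘L B = _
    rw [ContinuousLinearMap.comp_assoc, hJB, ContinuousLinearMap.comp_zero]
  set N := Ring.inverse (B + P) with hN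
  have hN1 : (B + P) * N = 1 := Ring.mul_inverse_cancel _ hu
  have hN2 : N * (B + P) = 1 := Ring.inverse_mul_cancel _ hu
  have hBl : (1 - P) * (B + P) = B := by
    have : (1 - P) * (B + P) = B + P - P * B - P * P := by noncomm_ring
    rw [this, hPB, hPP]; abel
  have hBr : (B + P) * (1 - P) = B := by
    have : (B + P) * (1 - P) = B + P - B * P - P * P := by noncomm_ring
    rw [this, hBP, hPP]; abel
  have hcomm : N * (1 - P) = (1 - P) * N := by
    calc N * (1 - P) = N * ((1 - P) * (B + P)) * N := by
          rw [mul_assoc, mul_assoc, hN1, mul_one]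
      _ = (1 - P) * N := by
          rw [hBl, ← hBr, ← mul_assoc, hN2, one_mul]
  have hzL : IsUnit (L - algebraMap ℂ (Y →L[ℂ] Y) z) := by
    rw [← neg_sub]
    exact (spectrum.mem_resolventSet_iff.1 hz).neg
  set K := Ring.inverse (L - algebraMap ℂ (Y →L[ℂ] Y) z) with hK
  have hK1 : (L - algebraMap ℂ (Y →L[ℂ] Y) z) ∘L K = 1 := Ring.mul_inverse_cancel _ hzL
  have hK2 : K ∘L (L - algebraMap ℂ (Y →L[ℂ] Y) z) = 1 := Ring.inverse_mul_cancel _ hzL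
  have hcompr : Jd ∘L (A - algebraMap ℂ (X →L[ℂ] X) z) ∘L Ju =
      L - algebraMap ℂ (Y →L[ℂ] Y) z := by
    ext y
    have h1 : Jd (Ju y) = y := congrArg (fun T : Y →L[ℂ] Y => T y) hJ
    simp [hL, Algebra.algebraMap_eq_smul_one, h1]
  -- The reduced resolvent of `B` is `S = (B + P)⁻¹ (1 - P)`, and `R = Ju (L - z)⁻¹ Jd` inverts the
  -- compression of `A - z`, which `hcompr` identifies with `L - z`.
  obtain ⟨C, hC, β₀, hβ₀, h⟩ := exists_norm_inverse_add_smul_sub_le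
    (D := A - algebraMap ℂ (X →L[ℂ] X) z) (B := B) (P := P) (S := N * (1 - P))
    (R := Ju ∘L K ∘L Jd)
    (by
      have : (1 - P) * B = B := by rw [sub_mul, one_mul, hPB, sub_zero]
      rw [mul_assoc, this]
      nth_rewrite 1 [← hBr]
      rw [← mul_assoc, hN2, one_mul])
    (by
      have : B * (1 - P) = B := by rw [mul_sub, mul_one, hBP, sub_zero]
      rw [hcomm, ← mul_assoc, this]
      nth_rewrite 1 [← hBl]
      rw [mul_assoc, hN1, mul_one])
    (by
      change B ∘L (Ju ∘L K ∘L Jd) = 0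
      rw [← ContinuousLinearMap.comp_assoc, hBJ, ContinuousLinearMap.zero_comp])
    (by
      change (Ju ∘L K ∘L Jd) ∘L B = 0
      rw [ContinuousLinearMap.comp_assoc, ContinuousLinearMap.comp_assoc, hJB,
        ContinuousLinearMap.comp_zero, ContinuousLinearMap.comp_zero])
    (by
      change Ju ∘L (Jd ∘L (A - algebraMap ℂ (X →L[ℂ] X) z) ∘L Ju) ∘L K ∘L Jd = _
      rw [hcompr, ← ContinuousLinearMap.comp_assoc _ K, hK1]
      rfl)
    (by
      change Ju ∘L (K ∘L (Jd ∘L (A - algebraMap ℂ (X →L[ℂ] X) z) ∘L Ju)) ∘L Jd = _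
      rw [hcompr, hK2]
      rfl)
  refine ⟨C, hC, β₀, hβ₀, fun β hβ => ?_⟩
  obtain ⟨h1, h2⟩ := h β hβ
  have e : A - algebraMap ℂ (X →L[ℂ] X) z + (β : ℂ) • B =
      A + (β : ℂ) • B - algebraMap ℂ (X →L[ℂ] X) z := by abel
  rw [e] at h1 h2
  refine ⟨?_, h2⟩
  rw [spectrum.mem_resolventSet_iff, ← neg_sub]
  exact h1.neg

end Reduction

/-! ### Matrices of operators and finite perturbations of the identity. -/

namespace WeightedL2

universe u w w'
variable {V : Type u} {W : Type w} {U : Type w'}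

/-- `T` is the operator with the matrix `k`. -/
def HasKernel {m : V → ℝ} {m' : W → ℝ} (T : WeightedL2 m →L[ℂ] WeightedL2 m')
    (k : W → V → ℝ) : Prop :=
  ∀ f w, T f w = ∑' v, (k w v : ℂ) * f v

variable {m : V → ℝ} {m' : W → ℝ} {m'' : U → ℝ}

theorem HasKernel.apply_delta (hm : ∀ v, 0 < m v) {T : WeightedL2 m →L[ℂ] WeightedL2 m'}
    {k : W → V → ℝ} (h : HasKernel T k) (u : V) (w : W) : T (delta m u) w = k w u := by
  rw [h, tsum_mul_delta hm]

theorem HasKernel.comp_apply_delta (hm : ∀ v, 0 < m v) {S : WeightedL2 m →L[ℂ] WeightedL2 m'}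
    {T : WeightedL2 m' →L[ℂ] WeightedL2 m''} {k : U → W → ℝ} {l : W → V → ℝ}
    (hT : HasKernel T k) (hS : HasKernel S l) (u : V) (w : U) :
    (T ∘L S) (delta m u) w = ((∑' v, k w v * l v u : ℝ) : ℂ) := by
  rw [ContinuousLinearMap.comp_apply, hT, Complex.ofReal_tsum]
  simp only [hS.apply_delta hm, Complex.ofReal_mul]

open Classical in
theorem one_apply_delta (hm : ∀ v, 0 < m v) (u w : V) :
    (1 : WeightedL2 m →L[ℂ] WeightedL2 m) (delta m u) w = ((if w = u then 1 else 0 : ℝ) : ℂ) := by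
  rw [one_apply_eq_self, delta_apply hm]
  split_ifs <;> simp

open Classical in
/-- The matrix `N` on the finite set `K`, extended by the identity. -/
def extendMatrix (K : Set V) (N : Matrix K K ℝ) (x y : V) : ℝ :=
  if h : x ∈ K ∧ y ∈ K then N ⟨x, h.1⟩ ⟨y, h.2⟩ else if x = y then 1 else 0

theorem extendMatrix_of_mem {K : Set V} (N : Matrix K K ℝ) (x y : K) :
    extendMatrix K N x y = N x y := by
  rw [extendMatrix, dif_pos ⟨x.2, y.2⟩]

open Classical in
theorem extendMatrix_of_notMem_left {K : Set V} (N : Matrix K K ℝ) {x : V} (hx : x ∉ K) (y : V) :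
    extendMatrix K N x y = if x = y then 1 else 0 := by
  rw [extendMatrix, dif_neg fun h => hx h.1]

open Classical in
theorem extendMatrix_of_notMem_right {K : Set V} (N : Matrix K K ℝ) (x : V) {y : V} (hy : y ∉ K) :
    extendMatrix K N x y = if x = y then 1 else 0 := by
  rw [extendMatrix, dif_neg fun h => hy h.2]

open Classical in
theorem extendMatrix_one {K : Set V} (x y : V) :
    extendMatrix K 1 x y = if x = y then 1 else 0 := by
  by_cases h : x ∈ K ∧ y ∈ K
  · rw [extendMatrix, dif_pos h, Matrix.one_apply]
    simp
  · rw [extendMatrix, dif_neg h]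

theorem tsum_extendMatrix_mul {K : Set V} [Fintype K] (N N' : Matrix K K ℝ) (x y : V) :
    ∑' z, extendMatrix K N x z * extendMatrix K N' z y = extendMatrix K (N * N') x y := by
  classical
  by_cases hx : x ∈ K
  · by_cases hy : y ∈ K
    · rw [← tsum_subtype_eq_of_support_subset (s := K), tsum_fintype,
        extendMatrix_of_mem _ ⟨x, hx⟩ ⟨y, hy⟩, Matrix.mul_apply]
      · refine Finset.sum_congr rfl fun z _ => ?_
        rw [extendMatrix_of_mem _ ⟨x, hx⟩ z, extendMatrix_of_mem _ z ⟨y, hy⟩]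
      · intro z hz
        by_contra hzK
        apply hz
        change extendMatrix K N x z * _ = 0
        rw [extendMatrix_of_notMem_right _ _ hzK, if_neg (fun h : x = z => hzK (h ▸ hx)), zero_mul]
    · rw [tsum_eq_single y]
      · rw [extendMatrix_of_notMem_right _ _ hy, extendMatrix_of_notMem_right _ _ hy,
          extendMatrix_of_notMem_right _ _ hy, if_pos rfl, mul_one]
      · intro z hz
        rw [extendMatrix_of_notMem_right _ _ hy, if_neg hz, mul_zero]
  · rw [tsum_eq_single x]
    · rw [extendMatrix_of_notMem_left _ hx, extendMatrix_of_notMem_left _ hx,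
          extendMatrix_of_notMem_left _ hx, if_pos rfl, one_mul]
    · intro z hz
      rw [extendMatrix_of_notMem_left _ hx, if_neg (fun h => hz h.symm), zero_mul]

theorem schurKernel_extendMatrix (hm : ∀ v, 0 < m v) {K : Set V} [Fintype K]
    (N : Matrix K K ℝ) : SchurKernel m m (extendMatrix K N) := by
  classical
  have hK : K.Finite := Set.toFinite K
  have hrow : ∀ w, {v | extendMatrix K N w v ≠ 0}.Finite := fun w => by
    refine (hK.insert w).subset fun v hv => ?_
    by_contra h
    rw [Set.mem_insert_iff, not_or] at h
    exact hv (by rw [extendMatrix_of_notMem_right _ _ h.2, if_neg fun e => h.1 e.symm])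
  have hcol : ∀ v, {w | extendMatrix K N w v ≠ 0}.Finite := fun v => by
    refine (hK.insert v).subset fun w hw => ?_
    by_contra h
    rw [Set.mem_insert_iff, not_or] at h
    exact hw (by rw [extendMatrix_of_notMem_left _ h.2, if_neg h.1])
  refine ⟨hrow, hcol, ?_⟩
  set r := fun w => ∑' v, |extendMatrix K N w v| with hr
  set c := fun v => (∑' w, |extendMatrix K N w v| * m w) / m v with hc
  have hr0 : ∀ w, 0 ≤ r w := fun w => tsum_nonneg fun _ => abs_nonneg _
  have hc0 : ∀ v, 0 ≤ c v := fun v =>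
    div_nonneg (tsum_nonneg fun w => mul_nonneg (abs_nonneg _) (hm w).le) (hm v).le
  have hS1 : 0 ≤ ∑ w : K, r w := Finset.sum_nonneg fun w _ => hr0 w
  have hS2 : 0 ≤ ∑ w : K, c w := Finset.sum_nonneg fun w _ => hc0 w
  -- Rows and columns outside `K` are those of the identity and need the bound `1`; the finitely
  -- many others are dominated by the sums.
  refine ⟨1 + ∑ w : K, r w + ∑ v : K, c v, by positivity, fun w => ?_, fun v => ?_⟩
  · change r w ≤ _
    by_cases hw : w ∈ K
    · have := Finset.single_le_sum (f := fun w : K => r w) (fun w _ => hr0 w)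
        (Finset.mem_univ ⟨w, hw⟩)
      simp only at this
      linarith
    · have : r w = 1 := by
        simp only [hr, extendMatrix_of_notMem_left N hw]
        rw [tsum_eq_single w (fun v hv => by rw [if_neg hv.symm, abs_zero])]
        simp
      linarith
  · rw [← div_le_iff₀ (hm v)]
    change c v ≤ _
    by_cases hv : v ∈ K
    · have := Finset.single_le_sum (f := fun w : K => c w) (fun w _ => hc0 w)
        (Finset.mem_univ ⟨v, hv⟩)
      simp only at this
      linarith
    · have : c v = 1 := by
        simp only [hc, extendMatrix_of_notMem_right N _ hv]
        rw [tsum_eq_single v (fun w hw => by rw [if_neg hw, abs_zero, zero_mul])]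
        simp [(hm v).ne']
      linarith

open Classical in
/-- An operator that differs from the identity by an invertible finite matrix is invertible. -/
theorem isUnit_of_extendMatrix (hm : ∀ v, 0 < m v) {K : Set V} [Fintype K] {N : Matrix K K ℝ}
    (hN : IsUnit N.det) {T : WeightedL2 m →L[ℂ] WeightedL2 m}
    (hT : ∀ x y, T (delta m y) x = extendMatrix K N x y) : IsUnit T := by
  obtain ⟨S, hS⟩ := (schurKernel_extendMatrix hm N).exists_clm hm hm
  obtain ⟨S', hS'⟩ := (schurKernel_extendMatrix hm N⁻¹).exists_clm hm hm
  have hk : HasKernel S (extendMatrix K N) := hS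
  have hk' : HasKernel S' (extendMatrix K N⁻¹) := hS'
  have hTS : T = S := clm_ext hm fun u w => by rw [hT, hk.apply_delta hm]
  rw [hTS]
  refine ⟨⟨S, S', ?_, ?_⟩, rfl⟩
  · refine clm_ext hm fun u w => ?_
    change (S ∘L S') (delta m u) w = _
    rw [hk.comp_apply_delta hm hk', tsum_extendMatrix_mul, Matrix.mul_nonsing_inv _ hN,
      extendMatrix_one, one_apply_delta hm]
  · refine clm_ext hm fun u w => ?_
    change (S' ∘L S) (delta m u) w = _
    rw [hk'.comp_apply_delta hm hk, tsum_extendMatrix_mul, Matrix.nonsing_inv_mul _ hN,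
      extendMatrix_one, one_apply_delta hm]

end WeightedL2

namespace WGraph

open WeightedL2

universe u
variable {V : Type u}

/-! ### Out-degree Laplacians as bounded operators. -/

section Laplacian

variable (G : WGraph V)

open Classical in
/-- The matrix of the out-degree Laplacian. -/
def lapOut (x y : V) : ℝ := ((if x = y then G.degOut x else 0) - G.a x y) / G.m x

theorem summable_a_left (x : V) : Summable fun y => G.a x y :=
  summable_of_finite (G.finite_in x) fun _ hy => G.a_eq_zero hy

theorem summable_a_right (y : V) : Summable fun x => G.a x y :=
  summable_of_finite (G.finite_out y) fun _ hy => G.a_eq_zero hy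

theorem degOut_nonneg (x : V) : 0 ≤ G.degOut x := tsum_nonneg fun _ => G.a_nonneg _ _

theorem lapOut_tsum_mul {𝕜 : Type*} [RCLike 𝕜] (x : V) (u : V → 𝕜) :
    ∑' y, (G.lapOut x y : 𝕜) * u y =
      (1 / (G.m x : 𝕜)) * ((G.degOut x : 𝕜) * u x - ∑' y, (G.a x y : 𝕜) * u y) := by
  classical
  have h1 : ∑' y, ((if x = y then G.degOut x else 0 : ℝ) : 𝕜) * u y = (G.degOut x : 𝕜) * u x := by
    rw [tsum_eq_single x (fun y hy => by simp [hy.symm])]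
    simp
  rw [← h1, ← Summable.tsum_sub, ← tsum_mul_left]
  · refine tsum_congr fun y => ?_
    rw [lapOut]
    push_cast
    ring
  · exact summable_of_finite (Set.finite_singleton x) fun y hy => by
      rw [if_neg (fun h => hy h.symm)]; simp
  · exact summable_of_finite (G.finite_in x) fun y hy => by rw [G.a_eq_zero hy]; simp

/-- With the mass as a weight, the transposed out-degree Laplacian is the unnormalized in-degree
Laplacian of the reversed graph; left kernels are thus harmonic functions there. -/
theorem tsum_mul_lapOut (y : V) (u : V → ℝ) :
    ∑' x, u x * G.m x * G.lapOut x y = u y * G.degOut y - ∑' x, u x * G.a x y := by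
  classical
  have h1 : ∑' x, u x * (if x = y then G.degOut x else 0) = u y * G.degOut y := by
    rw [tsum_eq_single y (fun x hx => by simp [hx])]
    simp
  rw [← h1, ← Summable.tsum_sub]
  · refine tsum_congr fun x => ?_
    rw [lapOut]
    have := (G.m_pos x).ne'
    field_simp
  · exact summable_of_finite (Set.finite_singleton y) fun x hx => by
      have hxy : x ≠ y := hx
      simp [hxy]
  · exact summable_of_finite (G.finite_out y) fun x hx => by rw [G.a_eq_zero hx]; simp

theorem isOutLaplacian_iff {T : WeightedL2 G.m →L[ℂ] WeightedL2 G.m} :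
    G.IsOutLaplacian T ↔ HasKernel T G.lapOut := by
  refine forall_congr' fun f => forall_congr' fun x => ?_
  have := G.lapOut_tsum_mul (𝕜 := ℂ) x f
  simp only [RCLike.ofReal_eq_complex_ofReal] at this
  rw [this]

variable {G}

theorem DegreeBounded.schurKernel_lapOut (h : G.DegreeBounded) :
    SchurKernel G.m G.m G.lapOut := by
  classical
  obtain ⟨C, hC, hb⟩ := h
  have hle : ∀ x y, |G.lapOut x y| ≤ ((if x = y then G.degOut x else 0) + G.a x y) / G.m x := by
    intro x y
    rw [lapOut, abs_div, abs_of_pos (G.m_pos x)]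
    refine div_le_div_of_nonneg_right ?_ (G.m_pos x).le
    refine (abs_sub _ _).trans (le_of_eq ?_)
    rw [abs_of_nonneg (G.a_nonneg x y), abs_of_nonneg]
    split_ifs
    exacts [G.degOut_nonneg x, le_rfl]
  have hrow : ∀ x, {y | G.lapOut x y ≠ 0}.Finite := fun x => by
    refine ((G.finite_in x).insert x).subset fun y hy => ?_
    by_contra h
    rw [Set.mem_insert_iff, not_or] at h
    exact hy (by rw [lapOut, if_neg (fun e => h.1 e.symm), G.a_eq_zero h.2, sub_zero, zero_div])
  have hcol : ∀ y, {x | G.lapOut x y ≠ 0}.Finite := fun y => by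
    refine ((G.finite_out y).insert y).subset fun x hx => ?_
    by_contra h
    rw [Set.mem_insert_iff, not_or] at h
    exact hx (by rw [lapOut, if_neg h.1, G.a_eq_zero h.2, sub_zero, zero_div])
  have s1 : ∀ x, Summable fun y => (if x = y then G.degOut x else 0) := fun x =>
    summable_of_finite (Set.finite_singleton x) fun y hy => if_neg fun h => hy h.symm
  have s2 : ∀ y, Summable fun x => (if x = y then G.degOut x else 0) := fun y =>
    summable_of_finite (Set.finite_singleton y) fun x hx => if_neg hx
  -- Rows are bounded by out-degree plus in-degree over the mass, columns by twice the out-degree.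
  refine ⟨hrow, hcol, 2 * C, by linarith, fun x => ?_, fun y => ?_⟩
  · have hs : Summable fun y => |G.lapOut x y| :=
      summable_of_finite (hrow x) fun y hy => by simpa using hy
    refine (hs.tsum_le_tsum (hle x) (((s1 x).add (G.summable_a_left x)).div_const _)).trans ?_
    rw [tsum_div_const, (s1 x).tsum_add (G.summable_a_left x),
      tsum_eq_single x (fun y hy => if_neg hy.symm), if_pos rfl, div_le_iff₀ (G.m_pos x)]
    have := hb x
    rw [degIn] at this
    linarith
  · have hs : Summable fun x => |G.lapOut x y| * G.m x :=
      summable_of_finite (hcol y) fun x hx => by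
        rw [Set.mem_ofPred_eq, not_not] at hx
        rw [hx, abs_zero, zero_mul]
    refine (hs.tsum_le_tsum (fun x => ?_) ((s2 y).add (G.summable_a_right y))).trans ?_
    · exact (le_div_iff₀ (G.m_pos x)).1 (hle x y)
    · rw [(s2 y).tsum_add (G.summable_a_right y), tsum_eq_single y (fun x hx => if_neg hx),
        if_pos rfl]
      have := (hb y).2
      rw [degOut] at this ⊢
      linarith

theorem DegreeBounded.exists_hasKernel (h : G.DegreeBounded) :
    ∃ T : WeightedL2 G.m →L[ℂ] WeightedL2 G.m, HasKernel T G.lapOut :=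
  h.schurKernel_lapOut.exists_clm G.m_pos G.m_pos

theorem restrict_a_le (F : Set (V × V)) (x y : V) : (G.restrict F).a x y ≤ G.a x y := by
  simp only [restrict]
  split_ifs
  exacts [le_rfl, G.a_nonneg x y]

theorem DegreeBounded.restrict (h : G.DegreeBounded) (F : Set (V × V)) :
    (G.restrict F).DegreeBounded := by
  obtain ⟨C, hC, hb⟩ := h
  refine ⟨C, hC, fun v => ⟨le_trans ?_ (hb v).1, le_trans ?_ (hb v).2⟩⟩
  · exact ((G.restrict F).summable_a_left v).tsum_le_tsum (restrict_a_le F v) (G.summable_a_left v)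
  · exact ((G.restrict F).summable_a_right v).tsum_le_tsum (fun x => restrict_a_le F x v)
      (G.summable_a_right v)

theorem restrict_a_add (F : Set (V × V)) (x y : V) :
    (G.restrict Fᶜ).a x y + (G.restrict F).a x y = G.a x y := by
  by_cases h : (x, y) ∈ F <;> simp [WGraph.restrict, h]

theorem lapOut_restrict_add (F : Set (V × V)) (x y : V) :
    (G.restrict Fᶜ).lapOut x y + (G.restrict F).lapOut x y = G.lapOut x y := by
  classical
  have hd : (G.restrict Fᶜ).degOut x + (G.restrict F).degOut x = G.degOut x := by
    rw [degOut, degOut, ← Summable.tsum_add ((G.restrict Fᶜ).summable_a_right x)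
      ((G.restrict F).summable_a_right x)]
    exact tsum_congr fun y => restrict_a_add F y x
  have ha := restrict_a_add (G := G) F x y
  rw [lapOut, lapOut, lapOut, ← hd, ← ha]
  change _ / G.m x + _ / G.m x = _
  rw [← add_div]
  split_ifs <;> ring

theorem restrict_edges_finite {F : Set (V × V)} (hF : F.Finite) :
    (G.restrict F).edges.Finite := by
  refine hF.subset fun e he => ?_
  by_contra h
  exact absurd he (by simp [edges, WGraph.restrict, h])

theorem transpose_edges_finite (h : G.edges.Finite) : G.transpose.edges.Finite :=
  (h.preimage Prod.swap_injective.injOn : (Prod.swap ⁻¹' G.edges).Finite)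

end Laplacian

/-! ### Masses, supports and biorthogonality of the reach vectors. -/

section ReachVectors

variable {T : WGraph V}

/-- The mass `∑ v, h_R(v) m(v)` of a reach, for its harmonic vector `h_R`. -/
def reachMass (T : WGraph V) (R : T.Reach) : ℝ := ∑' v, T.harmonicVec R.1 v * T.m v

/-- The harmonic vector of a reach. -/
def harm (T : WGraph V) (R : T.Reach) (v : V) : ℝ := T.harmonicVec R.1 v

/-- The normalized weight vector of a reach. -/
def wt (T : WGraph V) (R : T.Reach) (v : V) : ℝ := T.normalizedWeightVec R.1 v

theorem harm_nonneg (hE : T.edges.Finite) (R : T.Reach) (v : V) : 0 ≤ T.harm R v :=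
  harmonicVec_nonneg hE R.2 v

theorem wt_nonneg (hE : T.edges.Finite) (R : T.Reach) (v : V) : 0 ≤ T.wt R v :=
  normalizedWeightVec_nonneg hE R.2 v

open Classical in
theorem harm_eq_ite {R S : T.Reach} {v : V} (h : T.wt S v ≠ 0) :
    T.harm R v = if R = S then 1 else 0 := by
  rw [harm, harmonicVec_of_normalizedWeightVec_ne_zero R.2 S.2 h]
  exact if_congr Subtype.ext_iff.symm rfl rfl

theorem harm_finite (hE : T.edges.Finite) (R : T.Reach) : {v | T.harm R v ≠ 0}.Finite :=
  harmonicVec_finite hE R.2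

theorem harm_finite_reach (hE : T.edges.Finite) (v : V) : {R | T.harm R v ≠ 0}.Finite :=
  harmonicVec_finite_reach hE v

theorem mem_of_wt_ne_zero {R : T.Reach} {v : V} (h : T.wt R v ≠ 0) : v ∈ R.1 :=
  mem_of_weightVec_ne_zero (weightVec_ne_zero_of_normalized h)

theorem mem_of_harm_ne_zero {R : T.Reach} {v : V} (h : T.harm R v ≠ 0) : v ∈ R.1 := by
  by_contra hv
  exact h (harmonicVec_of_notMem hv)

theorem eq_reachableSet_of_wt_ne_zero {R : T.Reach} {v : V} (h : T.wt R v ≠ 0) :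
    R.1 = T.reachableSet v :=
  R.2.eq_of_weightVec_ne_zero (weightVec_ne_zero_of_normalized h)

theorem wt_finite (hE : T.edges.Finite) (R : T.Reach) : {v | T.wt R v ≠ 0}.Finite :=
  (R.2.finite hE).subset fun _ h => mem_of_wt_ne_zero h

theorem wt_finite_reach (hE : T.edges.Finite) (v : V) : {R | T.wt R v ≠ 0}.Finite :=
  (finite_setOf_mem_reach hE v).subset fun _ h => mem_of_wt_ne_zero h

theorem tsum_m_mul_wt (hE : T.edges.Finite) (R : T.Reach) : ∑' v, T.m v * T.wt R v = 1 :=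
  tsum_mul_normalizedWeightVec hE R.2

theorem tsum_wt_mul_m (hE : T.edges.Finite) (R : T.Reach) : ∑' v, T.wt R v * T.m v = 1 := by
  rw [← T.tsum_m_mul_wt hE R]
  exact tsum_congr fun v => mul_comm _ _

theorem tsum_harm (hE : T.edges.Finite) (v : V) : ∑' R, T.harm R v = 1 := tsum_harmonicVec hE v

theorem harm_balance (hE : T.edges.Finite) (R : T.Reach) (x : V) :
    ∑' y, T.a x y * T.harm R y = T.degIn x * T.harm R x := harmonicVec_harmonic hE R.2 x

theorem wt_balance (hE : T.edges.Finite) (R : T.Reach) (y : V) :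
    ∑' x, T.wt R x * T.a x y = T.wt R y * T.degIn y := normalizedWeightVec_balance hE R.2 y

theorem reachMass_pos (hE : T.edges.Finite) (R : T.Reach) : 0 < T.reachMass R := by
  obtain ⟨i, hi⟩ := R.2.exists_root
  have h1 : T.harmonicVec R.1 i = 1 := by
    have := R.2
    rw [hi] at this ⊢
    exact harmonicVec_of_mem_exclusivePart (root_mem_exclusivePart this)
  refine Summable.tsum_pos (summable_of_finite (harm_finite hE R) fun x hx => ?_)
    (fun v => mul_nonneg (harm_nonneg hE R v) (T.m_pos v).le) i ?_
  · rw [Set.mem_ofPred_eq, not_not] at hx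
    rw [← harm, hx, zero_mul]
  · rw [h1, one_mul]
    exact T.m_pos i

/-- For `v` in `S`, only the term of `S` itself survives: `wt R v ≠ 0` makes `v` a root of `R`, and
a reach containing that root equals `R`. -/
theorem projMass_wt_harm (hE : T.edges.Finite) (S : T.Reach) :
    projMass T.m T.wt T.harm S.1 = T.reachMass S := by
  have hS : ∑' u : S.1, T.harm S u * T.m u = T.reachMass S :=
    tsum_subtype_eq_of_support_subset fun u hu => mem_of_harm_ne_zero (left_ne_zero_of_mul hu)
  have h1 : ∀ v : S.1, (∑' R, T.wt R v * ∑' u : S.1, T.harm R u * T.m u) * T.m v =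
      T.reachMass S * (T.wt S v * T.m v) := by
    intro v
    rw [tsum_eq_single S, hS]
    · ring
    · intro R hR
      by_cases hw : T.wt R v = 0
      · rw [hw, zero_mul]
      · exact absurd (Subtype.ext (R.2.eq_of_mem S.2 (eq_reachableSet_of_wt_ne_zero hw) v.2)).symm hR
  rw [projMass, tsum_congr h1, tsum_mul_left,
    tsum_subtype_eq_of_support_subset (f := fun v => T.wt S v * T.m v), tsum_wt_mul_m hE, mul_one]
  exact fun u hu => mem_of_wt_ne_zero (left_ne_zero_of_mul hu)

theorem projMass_harm_wt (hE : T.edges.Finite) (S : T.Reach) :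
    projMass T.m T.harm T.wt S.1 = T.reachMass S := by
  have hS : ∑' u : S.1, T.wt S u * T.m u = 1 := by
    rw [tsum_subtype_eq_of_support_subset (f := fun v => T.wt S v * T.m v), tsum_wt_mul_m hE]
    exact fun u hu => mem_of_wt_ne_zero (left_ne_zero_of_mul hu)
  have h1 : ∀ v : S.1, (∑' R, T.harm R v * ∑' u : S.1, T.wt R u * T.m u) * T.m v =
      T.harm S v * T.m v := by
    intro v
    rw [tsum_eq_single S, hS, mul_one]
    intro R hR
    have : ∑' u : S.1, T.wt R u * T.m u = 0 := by
      rw [← tsum_zero (α := ℝ) (β := S.1)]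
      refine tsum_congr fun u => ?_
      by_cases hw : T.wt R u = 0
      · rw [hw, zero_mul]
      · exact absurd (Subtype.ext (R.2.eq_of_mem S.2 (eq_reachableSet_of_wt_ne_zero hw) u.2)).symm hR
    rw [this, mul_zero]
  rw [projMass, tsum_congr h1, tsum_subtype_eq_of_support_subset (f := fun v => T.harm S v * T.m v)]
  · rfl
  · exact fun u hu => mem_of_harm_ne_zero (left_ne_zero_of_mul hu)

theorem sees_iff_of_notMem {v w : V} (hv : ∀ w, ¬ 0 < T.a v w) : Sees T.edges v w ↔ v = w := by
  constructor
  · intro h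
    rcases Relation.ReflTransGen.cases_head h with rfl | ⟨b, hb, -⟩
    · rfl
    · exact absurd hb (hv b)
  · rintro rfl
    exact Relation.ReflTransGen.refl

/-- The contribution of the reaches to the matrix of the spectral projection. -/
def wtHarm (T : WGraph V) (x y : V) : ℝ := ∑' R, T.wt R x * (T.harm R y * T.m y)

/-- The set of endpoints of edges. -/
def endpoints (T : WGraph V) : Set V := Prod.fst '' T.edges ∪ Prod.snd '' T.edges

theorem endpoints_finite (hE : T.edges.Finite) : T.endpoints.Finite :=
  (hE.image _).union (hE.image _)

theorem a_eq_zero_of_notMem_left {x : V} (hx : x ∉ T.endpoints) (y : V) : T.a x y = 0 :=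
  T.a_eq_zero fun h => hx (Or.inl ⟨(x, y), h, rfl⟩)

theorem a_eq_zero_of_notMem_right (x : V) {y : V} (hy : y ∉ T.endpoints) : T.a x y = 0 :=
  T.a_eq_zero fun h => hy (Or.inr ⟨(x, y), h, rfl⟩)

theorem sees_iff_of_notMem_right {v w : V} (hw : w ∉ T.endpoints) :
    Sees T.edges v w ↔ v = w := by
  constructor
  · intro h
    rcases Relation.ReflTransGen.cases_tail h with rfl | ⟨b, -, hb⟩
    · rfl
    · exact absurd (Or.inr ⟨_, hb, rfl⟩) hw
  · rintro rfl
    exact Relation.ReflTransGen.refl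

theorem sees_iff_of_notMem_left {v w : V} (hv : v ∉ T.endpoints) :
    Sees T.edges v w ↔ v = w :=
  sees_iff_of_notMem fun w => by rw [a_eq_zero_of_notMem_left hv]; exact lt_irrefl _

theorem eq_singleton_of_mem {R : T.Reach} {v : V} (hv : v ∉ T.endpoints) (h : v ∈ R.1) :
    R.1 = {v} := by
  obtain ⟨i, hi⟩ := R.2.exists_root
  rw [hi] at h ⊢
  have : v = i := (sees_iff_of_notMem_left hv).1 h
  subst this
  ext w
  exact sees_iff_of_notMem_right hv

theorem exists_reach_eq_singleton (hE : T.edges.Finite) {v : V} (hv : v ∉ T.endpoints) :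
    ∃ R : T.Reach, R.1 = {v} := by
  obtain ⟨j, hj, hs⟩ := exists_isReach_sees hE v
  have : v ∈ T.reachableSet j := hs
  exact ⟨⟨_, hj⟩, eq_singleton_of_mem (R := ⟨_, hj⟩) hv this⟩

theorem wt_singleton (hE : T.edges.Finite) {R : T.Reach} {v : V} (hR : R.1 = {v}) :
    T.wt R v * T.m v = 1 := by
  rw [← tsum_wt_mul_m hE R, tsum_eq_single v]
  intro w hw
  have : T.wt R w = 0 := by
    by_contra h
    have := mem_of_wt_ne_zero h
    rw [hR] at this
    exact hw this
  rw [this, zero_mul]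

theorem harm_singleton {R : T.Reach} {v : V} (hR : R.1 = {v}) : T.harm R v = 1 := by
  obtain ⟨i, hi⟩ := R.2.exists_root
  have hvi : i = v := by
    have : i ∈ R.1 := hi ▸ mem_reachableSet_self i
    rw [hR] at this
    exact this
  subst hvi
  have := R.2
  rw [harm]
  rw [hi] at this ⊢
  exact harmonicVec_of_mem_exclusivePart (root_mem_exclusivePart this)

open Classical in
-- A vertex that meets no edge forms a singleton reach and lies in no other, so the projection acts
-- there as the identity.
theorem wtHarm_of_notMem (hE : T.edges.Finite) {x y : V}
    (h : x ∉ T.endpoints ∨ y ∉ T.endpoints) : T.wtHarm x y = if x = y then 1 else 0 := by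
  have off : x ≠ y → T.wtHarm x y = 0 := by
    intro hxy
    rw [wtHarm, ← tsum_zero (α := ℝ) (β := T.Reach)]
    refine tsum_congr fun R => ?_
    by_contra hne
    have hx := mem_of_wt_ne_zero (left_ne_zero_of_mul hne)
    have hy := mem_of_harm_ne_zero (left_ne_zero_of_mul (right_ne_zero_of_mul hne))
    rcases h with h | h
    · rw [eq_singleton_of_mem h hx] at hy
      exact hxy hy.symm
    · rw [eq_singleton_of_mem h hy] at hx
      exact hxy hx
  split_ifs with hxy
  · subst hxy
    have hx : x ∉ T.endpoints := h.elim id id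
    obtain ⟨S, hS⟩ := exists_reach_eq_singleton hE hx
    rw [wtHarm, tsum_eq_single S]
    · rw [harm_singleton hS, one_mul, wt_singleton hE hS]
    · intro R hR
      by_contra hne
      exact hR (Subtype.ext ((eq_singleton_of_mem hx
        (mem_of_wt_ne_zero (left_ne_zero_of_mul hne))).trans hS.symm))
  · exact off hxy

/-- Off the endpoints of edges the sum comes from a singleton reach and equals `1`; only finitely
many vertices remain. -/
theorem exists_tsum_reachMass_mul_wt_le (hE : T.edges.Finite) :
    ∃ C : ℝ, 0 < C ∧ ∀ v, ∑' R, T.reachMass R * T.wt R v ≤ C := by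
  have : Fintype T.endpoints := (endpoints_finite hE).fintype
  set q := fun v => ∑' R, T.reachMass R * T.wt R v with hq
  have hq0 : ∀ v, 0 ≤ q v := fun v =>
    tsum_nonneg fun R => mul_nonneg (reachMass_pos hE R).le (wt_nonneg hE R v)
  refine ⟨1 + ∑ v : T.endpoints, q v, by
    have : 0 ≤ ∑ v : T.endpoints, q v := Finset.sum_nonneg fun v _ => hq0 v
    linarith, fun v => ?_⟩
  by_cases hv : v ∈ T.endpoints
  · have := Finset.single_le_sum (f := fun v : T.endpoints => q v) (fun v _ => hq0 v)
      (Finset.mem_univ ⟨v, hv⟩)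
    simp only at this
    change q v ≤ _
    linarith
  · obtain ⟨S, hS⟩ := exists_reach_eq_singleton hE hv
    rw [tsum_eq_single S]
    · have h1 : T.reachMass S = T.m v := by
        rw [reachMass, tsum_eq_single v]
        · have := harm_singleton hS
          rw [harm] at this
          rw [this, one_mul]
        · intro w hw
          rw [harmonicVec_of_notMem (by rw [hS]; exact hw), zero_mul]
      rw [h1, mul_comm, wt_singleton hE hS]
      have : 0 ≤ ∑ v : T.endpoints, q v := Finset.sum_nonneg fun v _ => hq0 v
      linarith
    · intro R hne
      by_contra h
      exact hne (Subtype.ext ((eq_singleton_of_mem hv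
        (mem_of_wt_ne_zero (right_ne_zero_of_mul h))).trans hS.symm))

/-- A harmonic function that is orthogonal to all weight vectors vanishes. -/
theorem nonpos_of_harmonic (hE : T.edges.Finite) {u : V → ℝ} (hfin : {x | u x ≠ 0}.Finite)
    (hharm : ∀ x, ∑' y, T.a x y * u y = T.degIn x * u x)
    (horth : ∀ R, ∑' x, u x * (T.m x * T.wt R x) = 0) (x : V) : u x ≤ 0 := by
  by_contra hx
  obtain ⟨x, hx, hmax⟩ := exists_max_of_pos hfin (not_le.1 hx)
  obtain ⟨i, hi, hs⟩ := exists_isReach_sees hE x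
  have hui := T.eq_of_sees_of_subharmonic hmax (fun y _ => (hharm y).ge) rfl hs
  obtain ⟨S, hS⟩ : ∃ S : T.Reach, S.1 = T.reachableSet i := ⟨⟨_, hi⟩, rfl⟩
  have h := horth S
  -- The weight vector lives on roots of `S`. They are all seen by `i`, so `u` attains its maximum
  -- on them, and orthogonality to a vector of total mass one makes this maximum zero.
  have h2 : ∀ y, u y * (T.m y * T.wt S y) = u x * (T.m y * T.wt S y) := by
    intro y
    by_cases hy : T.wt S y = 0
    · simp [hy]
    · have hroot := eq_reachableSet_of_wt_ne_zero hy
      have hsee : i ∈ T.reachableSet y := hroot ▸ hS ▸ mem_reachableSet_self i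
      rw [T.eq_of_sees_of_subharmonic hmax (fun y _ => (hharm y).ge) hui hsee]
  rw [tsum_congr h2, tsum_mul_left, tsum_m_mul_wt hE, mul_one] at h
  exact hx.ne' h

end ReachVectors

end WGraph

namespace WGraph

open WeightedL2

universe u
variable {V : Type u}

theorem tsum_comm_of_finite {α β : Type*} {f : α → β → ℝ}
    (h : {p : α × β | f p.1 p.2 ≠ 0}.Finite) : ∑' a, ∑' b, f a b = ∑' b, ∑' a, f a b := by
  refine (Summable.tsum_comm (summable_of_finite (f := Function.uncurry f) h fun p hp => ?_)).symm
  rwa [Set.mem_ofPred_eq, not_not] at hp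

/-! ### The reduced graph and its degrees. -/

section Coupling

variable (G T : WGraph V)

/-- The coupling `∑ h_R(r) a(r, s) w_S(s)` of two reaches of `T` by the edges of `G`. -/
def coupling (R S : T.Reach) : ℝ := ∑' r, ∑' s, T.harm R r * G.a r s * T.wt S s

variable {G T}

theorem coupling_nonneg (hE : T.edges.Finite) (R S : T.Reach) : 0 ≤ coupling G T R S :=
  tsum_nonneg fun r => tsum_nonneg fun s =>
    mul_nonneg (mul_nonneg (harm_nonneg hE R r) (G.a_nonneg r s)) (wt_nonneg hE S s)

theorem exists_of_coupling_ne_zero {R S : T.Reach} (h : coupling G T R S ≠ 0) :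
    ∃ r s, T.harm R r ≠ 0 ∧ 0 < G.a r s ∧ T.wt S s ≠ 0 := by
  by_contra! hall
  apply h
  rw [coupling, ← tsum_zero (α := ℝ) (β := V)]
  refine tsum_congr fun r => ?_
  rw [← tsum_zero (α := ℝ) (β := V)]
  refine tsum_congr fun s => ?_
  by_cases h1 : T.harm R r = 0
  · simp [h1]
  by_cases h2 : 0 < G.a r s
  · rw [hall r s h1 h2, mul_zero]
  · rw [G.a_eq_zero h2]; simp

theorem coupling_finite_in (hE : T.edges.Finite) (R : T.Reach) :
    {S | coupling G T R S ≠ 0}.Finite := by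
  refine ((harm_finite hE R).biUnion fun r _ => (G.finite_in r).biUnion fun s _ =>
    wt_finite_reach hE s).subset fun S hS => ?_
  obtain ⟨r, s, h1, h2, h3⟩ := exists_of_coupling_ne_zero hS
  exact Set.mem_biUnion h1 (Set.mem_biUnion h2 h3)

theorem coupling_finite_out (hE : T.edges.Finite) (S : T.Reach) :
    {R | coupling G T R S ≠ 0}.Finite := by
  refine ((wt_finite hE S).biUnion fun s _ => (G.finite_out s).biUnion fun r _ =>
    harm_finite_reach hE r).subset fun R hR => ?_
  obtain ⟨r, s, h1, h2, h3⟩ := exists_of_coupling_ne_zero hR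
  exact Set.mem_biUnion h3 (Set.mem_biUnion h2 h1)

/-- The reduced graph on the reaches of `T`. -/
def reducedGraph (G : WGraph V) (hE : T.edges.Finite) : WGraph T.Reach where
  m := T.reachMass
  a := fun R S => coupling G T R S * T.reachMass S
  m_pos := reachMass_pos hE
  a_nonneg := fun R S => mul_nonneg (coupling_nonneg hE R S) (reachMass_pos hE S).le
  finite_in := fun R => (coupling_finite_in hE R).subset fun _ hS =>
    left_ne_zero_of_mul (ne_of_gt (show (0 : ℝ) < _ from hS))
  finite_out := fun S => (coupling_finite_out hE S).subset fun _ hR =>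
    left_ne_zero_of_mul (ne_of_gt (show (0 : ℝ) < _ from hR))

/-- Row sums of the coupling, weighted by `c`. -/
theorem tsum_coupling_mul (hE : T.edges.Finite) (R : T.Reach) (c : T.Reach → ℝ) :
    ∑' S, coupling G T R S * c S =
      ∑' r, ∑' s, T.harm R r * G.a r s * ∑' S, c S * T.wt S s := by
  have hrow : ∀ r s, G.a r s = 0 → ∀ x, T.harm R r * G.a r s * x = 0 := fun r s h x => by
    rw [h, mul_zero, zero_mul]
  have hfin : ∀ g : V → ℝ, ∑' r, ∑' s, T.harm R r * G.a r s * g s =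
      ∑ r ∈ (harm_finite hE R).toFinset, ∑ s ∈ (G.finite_in r).toFinset,
        T.harm R r * G.a r s * g s := by
    intro g
    rw [tsum_eq_sum_of_finite (harm_finite hE R)]
    · exact Finset.sum_congr rfl fun r _ => tsum_eq_sum_of_finite (G.finite_in r)
        fun s hs => hrow r s (G.a_eq_zero hs) _
    · intro r hr
      rw [Set.mem_ofPred_eq, not_not] at hr
      simp [hr]
  rw [hfin]
  have hs : ∀ s, Summable fun S => c S * T.wt S s := fun s =>
    summable_of_finite (wt_finite_reach hE s) fun S hS => by
      rw [Set.mem_ofPred_eq, not_not] at hS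
      rw [hS, mul_zero]
  simp only [← tsum_mul_left]
  have hsum : ∀ r s, Summable fun S => T.harm R r * G.a r s * (c S * T.wt S s) := fun r s =>
    (hs s).mul_left _
  have : ∀ r, ∑ s ∈ (G.finite_in r).toFinset, ∑' S, T.harm R r * G.a r s * (c S * T.wt S s) =
      ∑' S, ∑ s ∈ (G.finite_in r).toFinset, T.harm R r * G.a r s * (c S * T.wt S s) := fun r =>
    (Summable.tsum_finsetSum fun s _ => hsum r s).symm
  simp only [this]
  rw [← Summable.tsum_finsetSum fun r _ => summable_sum fun s _ => hsum r s]
  refine tsum_congr fun S => ?_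
  rw [coupling, hfin, Finset.sum_mul]
  refine Finset.sum_congr rfl fun r _ => ?_
  rw [Finset.sum_mul]
  exact Finset.sum_congr rfl fun s _ => by ring

theorem coupling_swap (hE : T.edges.Finite) (R S : T.Reach) :
    coupling G T R S = ∑' s, ∑' r, T.wt S s * G.a r s * T.harm R r := by
  rw [coupling, tsum_comm_of_finite]
  · exact tsum_congr fun s => tsum_congr fun r => by ring
  · refine ((harm_finite hE R).prod (wt_finite hE S)).subset fun p hp => ?_
    exact ⟨left_ne_zero_of_mul (left_ne_zero_of_mul hp), right_ne_zero_of_mul hp⟩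

/-- Column sums of the coupling. -/
theorem tsum_coupling (hE : T.edges.Finite) (S : T.Reach) :
    ∑' R, coupling G T R S = ∑' s, T.wt S s * G.degOut s := by
  have hfin : ∀ g : V → ℝ, ∑' s, ∑' r, T.wt S s * G.a r s * g r =
      ∑ s ∈ (wt_finite hE S).toFinset, ∑ r ∈ (G.finite_out s).toFinset,
        T.wt S s * G.a r s * g r := by
    intro g
    rw [tsum_eq_sum_of_finite (wt_finite hE S)]
    · exact Finset.sum_congr rfl fun s _ => tsum_eq_sum_of_finite (G.finite_out s)
        fun r hr => by rw [G.a_eq_zero hr]; simp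
    · intro r hr
      rw [Set.mem_ofPred_eq, not_not] at hr
      simp [hr]
  have hs : ∀ s r, Summable fun R => T.wt S s * G.a r s * T.harm R r := fun s r =>
    (summable_of_finite (harm_finite_reach hE r) fun R hR => by simpa using hR).mul_left _
  simp only [coupling_swap hE, hfin]
  -- All sums over vertices are finite, so the sum over reaches moves inside, where the harmonic
  -- vectors add up to `1`.
  rw [Summable.tsum_finsetSum fun s _ => summable_sum fun r _ => hs s r,
    tsum_eq_sum_of_finite (wt_finite hE S)]
  · refine Finset.sum_congr rfl fun s _ => ?_
    rw [Summable.tsum_finsetSum fun r _ => hs s r]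
    simp only [tsum_mul_left, tsum_harm hE, mul_one]
    rw [← Finset.mul_sum, degOut, tsum_eq_sum_of_finite (G.finite_out s) fun r hr => G.a_eq_zero hr]
  · intro r hr
    rw [Set.mem_ofPred_eq, not_not] at hr
    rw [hr, zero_mul]

theorem reducedGraph_degOut (hE : T.edges.Finite) (S : T.Reach) :
    (reducedGraph G hE).degOut S = T.reachMass S * ∑' s, T.wt S s * G.degOut s := by
  change ∑' R, coupling G T R S * T.reachMass S = _
  rw [tsum_mul_right, tsum_coupling hE, mul_comm]

/-- In-degrees use the uniform bound on `∑ reachMass S * wt S s`; out-degrees use that harmonic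
vectors sum to `1` and weight vectors have total mass `1`. -/
theorem reducedGraph_degreeBounded (hE : T.edges.Finite) (hm : T.m = G.m)
    (h : G.DegreeBounded) : (reducedGraph G hE).DegreeBounded := by
  obtain ⟨C, hC, hb⟩ := h
  obtain ⟨C', hC', hb'⟩ := exists_tsum_reachMass_mul_wt_le hE
  have key : ∀ R, (reducedGraph G hE).degIn R ≤ C' * C * T.reachMass R := by
    intro R
    change ∑' S, coupling G T R S * T.reachMass S ≤ _
    rw [tsum_coupling_mul hE, reachMass, ← tsum_mul_left]
    have hs : ∀ (r : V) (g : V → ℝ), Summable fun s => T.harm R r * G.a r s * g s := fun r g =>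
      summable_of_finite (G.finite_in r) fun s hs => by rw [G.a_eq_zero hs]; simp
    refine Summable.tsum_le_tsum (fun r => ?_) ?_ ?_
    · calc _ ≤ ∑' s, T.harm R r * G.a r s * C' :=
            (hs r _).tsum_le_tsum (fun s => mul_le_mul_of_nonneg_left (hb' s)
              (mul_nonneg (harm_nonneg hE R r) (G.a_nonneg r s))) (hs r _)
        _ = T.harm R r * C' * G.degIn r := by
            rw [tsum_mul_right, tsum_mul_left, degIn]; ring
        _ ≤ T.harm R r * C' * (C * G.m r) :=
            mul_le_mul_of_nonneg_left (hb r).1 (mul_nonneg (harm_nonneg hE R r) hC'.le)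
        _ = C' * C * (T.harmonicVec R.1 r * T.m r) := by rw [hm, harm]; ring
    · exact summable_of_finite (harm_finite hE R) fun r hr => by
        rw [Set.mem_ofPred_eq, not_not] at hr; simp [hr]
    · refine summable_of_finite (harm_finite hE R) fun r hr => ?_
      rw [Set.mem_ofPred_eq, not_not] at hr
      rw [← harm, hr]; simp
  refine ⟨C' * C + C, by positivity, fun R => ⟨?_, ?_⟩⟩
  · refine (key R).trans ?_
    have := mul_pos hC (reachMass_pos hE R)
    change _ ≤ (C' * C + C) * T.reachMass R
    linarith
  · rw [reducedGraph_degOut]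
    have h1 : ∑' s, T.wt R s * G.degOut s ≤ C := by
      calc _ ≤ ∑' s, C * (T.m s * T.wt R s) := by
            refine Summable.tsum_le_tsum (fun s => ?_) ?_ ?_
            · have := mul_le_mul_of_nonneg_left (hb s).2 (wt_nonneg hE R s)
              rw [hm]
              linarith
            · exact summable_of_finite (wt_finite hE R) fun r hr => by
                rw [Set.mem_ofPred_eq, not_not] at hr; simp [hr]
            · exact summable_of_finite (wt_finite hE R) fun r hr => by
                rw [Set.mem_ofPred_eq, not_not] at hr; simp [hr]
        _ = C := by rw [tsum_mul_left, tsum_m_mul_wt hE, mul_one]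
    have h2 := mul_le_mul_of_nonneg_left h1 (reachMass_pos hE R).le
    have := mul_pos (mul_pos hC' hC) (reachMass_pos hE R)
    change _ ≤ (C' * C + C) * T.reachMass R
    linarith

theorem tsum_coe_coupling (R S : T.Reach) :
    ∑' r : R.1, ∑' s : S.1, T.harm R r * G.a r s * T.wt S s = coupling G T R S := by
  have h1 : ∀ r : V, ∑' s : S.1, T.harm R r * G.a r s * T.wt S s =
      ∑' s, T.harm R r * G.a r s * T.wt S s := fun r =>
    tsum_subtype_eq_of_support_subset (f := fun s => T.harm R r * G.a r s * T.wt S s)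
      fun s hs => mem_of_wt_ne_zero (right_ne_zero_of_mul hs)
  simp only [h1]
  refine tsum_subtype_eq_of_support_subset
    (f := fun r => ∑' s, T.harm R r * G.a r s * T.wt S s) fun r hr => ?_
  by_contra hrR
  refine hr ?_
  have : T.harm R r = 0 := by
    by_contra h
    exact hrR (mem_of_harm_ne_zero h)
  simp [this]

end Coupling

/-! ### Boundedness and biorthogonality of projection and interpolation. -/

section Operators

variable {T : WGraph V}

/-- The matrix of the projection `J⁺↓`. -/
def downKernel (T : WGraph V) (R : T.Reach) (v : V) : ℝ := T.harm R v * T.m v / T.reachMass R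

/-- The matrix of the interpolation `J⁺↑`. -/
def upKernel (T : WGraph V) (v : V) (R : T.Reach) : ℝ := T.reachMass R * T.wt R v

theorem downKernel_nonneg (hE : T.edges.Finite) (R : T.Reach) (v : V) : 0 ≤ T.downKernel R v :=
  div_nonneg (mul_nonneg (harm_nonneg hE R v) (T.m_pos v).le) (reachMass_pos hE R).le

theorem upKernel_nonneg (hE : T.edges.Finite) (v : V) (R : T.Reach) : 0 ≤ T.upKernel v R :=
  mul_nonneg (reachMass_pos hE R).le (wt_nonneg hE R v)

theorem schurKernel_downKernel (hE : T.edges.Finite) :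
    SchurKernel T.m T.reachMass T.downKernel := by
  have hne : ∀ {R v}, T.downKernel R v ≠ 0 → T.harm R v ≠ 0 := fun h h0 =>
    h (by rw [downKernel, h0, zero_mul, zero_div])
  refine ⟨fun R => (harm_finite hE R).subset fun v hv => hne hv,
    fun v => (harm_finite_reach hE v).subset fun R hR => hne hR, 1, zero_le_one,
    fun R => ?_, fun v => ?_⟩
  · simp only [abs_of_nonneg (downKernel_nonneg hE _ _)]
    simp only [downKernel]
    rw [tsum_div_const]
    exact (div_self (reachMass_pos hE R).ne').le
  · simp only [abs_of_nonneg (downKernel_nonneg hE _ _)]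
    have : ∀ R, T.downKernel R v * T.reachMass R = T.harm R v * T.m v := fun R =>
      div_mul_cancel₀ _ (reachMass_pos hE R).ne'
    rw [tsum_congr this, tsum_mul_right, tsum_harm hE]

theorem schurKernel_upKernel (hE : T.edges.Finite) :
    SchurKernel T.reachMass T.m T.upKernel := by
  obtain ⟨C, hC, hb⟩ := exists_tsum_reachMass_mul_wt_le hE
  have hne : ∀ {R v}, T.upKernel v R ≠ 0 → T.wt R v ≠ 0 := fun h => right_ne_zero_of_mul h
  refine ⟨fun v => (wt_finite_reach hE v).subset fun R hR => hne hR,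
    fun R => (wt_finite hE R).subset fun v hv => hne hv, C + 1, by linarith,
    fun v => ?_, fun R => ?_⟩
  · simp only [abs_of_nonneg (upKernel_nonneg hE _ _)]
    exact (hb v).trans (by linarith)
  · simp only [abs_of_nonneg (upKernel_nonneg hE _ _)]
    simp only [upKernel, mul_assoc]
    rw [tsum_mul_left, tsum_wt_mul_m hE, mul_one]
    have := mul_pos hC (reachMass_pos hE R)
    linarith

open Classical in
-- Here `Jd Ju = 1`: on the support of `wt S` the harmonic vector of `R` is the Kronecker symbol.
theorem tsum_downKernel_mul_upKernel (hE : T.edges.Finite) (R S : T.Reach) :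
    ∑' v, T.downKernel R v * T.upKernel v S = if R = S then 1 else 0 := by
  have h : ∀ v, T.downKernel R v * T.upKernel v S =
      (if R = S then 1 else 0) * (T.reachMass S / T.reachMass R) * (T.m v * T.wt S v) := by
    intro v
    by_cases hw : T.wt S v = 0
    · simp [upKernel, hw]
    · rw [downKernel, harm_eq_ite hw, upKernel]
      ring
  rw [tsum_congr h, tsum_mul_left, tsum_m_mul_wt hE, mul_one]
  split_ifs with hRS
  · rw [hRS, div_self (reachMass_pos hE S).ne', one_mul]
  · rw [zero_mul]

theorem tsum_upKernel_mul_downKernel (hE : T.edges.Finite) (x y : V) :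
    ∑' R, T.upKernel x R * T.downKernel R y = T.wtHarm x y := by
  refine tsum_congr fun R => ?_
  rw [upKernel, downKernel]
  have := (reachMass_pos hE R).ne'
  field_simp

end Operators

end WGraph

namespace WGraph

open WeightedL2

universe u
variable {V : Type u}

/-! ### The kernel of the cluster Laplacian and the invertibility of `B + P`. -/

section Cluster

variable {K : WGraph V}

/-- `B Ju = 0` is the balance equation of the weight vectors: reversing edges turns out-degrees into
in-degrees. -/
theorem tsum_lapOut_mul_upKernel (hE : K.transpose.edges.Finite) (S : K.transpose.Reach) (x : V) :
    ∑' v, K.lapOut x v * K.transpose.upKernel v S = 0 := by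
  have h := K.lapOut_tsum_mul (𝕜 := ℝ) x (fun v => K.transpose.upKernel v S)
  simp only [RCLike.ofReal_real_eq_id, id] at h
  rw [h]
  have hb := wt_balance hE S x
  simp only [upKernel, mul_left_comm (K.a _ _), tsum_mul_left]
  have h2 : ∑' v, K.a x v * K.transpose.wt S v = K.transpose.wt S x * K.degOut x := by
    refine Eq.trans (tsum_congr fun v => mul_comm _ _) hb
  rw [h2]
  ring

/-- `Jd B = 0` is the harmonicity of the harmonic vectors on the reversed graph. -/
theorem tsum_downKernel_mul_lapOut (hE : K.transpose.edges.Finite) (R : K.transpose.Reach) (y : V) :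
    ∑' v, K.transpose.downKernel R v * K.lapOut v y = 0 := by
  have h := K.tsum_mul_lapOut y (fun v => K.transpose.harm R v)
  have hb := harm_balance hE R y
  have h2 : ∑' v, K.transpose.harm R v * K.a v y = K.degOut y * K.transpose.harm R y := by
    refine Eq.trans (tsum_congr fun v => mul_comm _ _) hb
  rw [h2, mul_comm, sub_self] at h
  have : ∀ v, K.transpose.downKernel R v * K.lapOut v y =
      K.transpose.harm R v * K.m v * K.lapOut v y / K.transpose.reachMass R := fun v => by
    rw [downKernel, div_mul_eq_mul_div]
    rfl
  rw [tsum_congr this, tsum_div_const, h, zero_div]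

theorem lapOut_eq_zero_of_notMem {x y : V}
    (h : x ∉ K.transpose.endpoints ∨ y ∉ K.transpose.endpoints) : K.lapOut x y = 0 := by
  classical
  have ha : K.a x y = 0 := by
    rcases h with h | h
    · exact a_eq_zero_of_notMem_right (T := K.transpose) y h
    · exact a_eq_zero_of_notMem_left (T := K.transpose) h x
  rw [lapOut, ha, sub_zero]
  by_cases hxy : x = y
  · subst hxy
    have : K.degOut x = 0 := by
      rw [degOut, ← tsum_zero (α := ℝ) (β := V)]
      exact tsum_congr fun j => a_eq_zero_of_notMem_left (T := K.transpose) (h.elim id id) j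
    rw [this, ite_self, zero_div]
  · rw [if_neg hxy, zero_div]

/-- The out-degree Laplacian plus its spectral projection has no left kernel. -/
theorem eq_zero_of_tsum_mul_eq_zero (hE : K.transpose.edges.Finite) {u : V → ℝ}
    (hu : {x | u x ≠ 0}.Finite)
    (h : ∀ y, ∑' x, u x * K.m x * (K.lapOut x y + K.transpose.wtHarm x y) = 0) (x : V) :
    u x = 0 := by
  set T := K.transpose with hT
  set c : T.Reach → ℝ := fun R => ∑' x, u x * (T.m x * T.wt R x) with hc
  have hu' : ∀ x, x ∉ {x | u x ≠ 0} → u x = 0 := fun x hx => by simpa using hx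
  have hP : ∀ y, ∑' x, u x * K.m x * T.wtHarm x y = (∑' R, c R * T.harm R y) * T.m y := by
    intro y
    simp only [wtHarm, hc, ← tsum_mul_left, ← tsum_mul_right]
    rw [tsum_comm_of_finite]
    · refine tsum_congr fun R => tsum_congr fun x => ?_
      change u x * K.m x * (T.wt R x * (T.harm R y * K.m y)) =
        u x * (K.m x * T.wt R x) * T.harm R y * K.m y
      ring
    · refine (hu.prod (harm_finite_reach hE y)).subset fun p hp => ?_
      exact ⟨left_ne_zero_of_mul (left_ne_zero_of_mul hp),
        left_ne_zero_of_mul (right_ne_zero_of_mul (right_ne_zero_of_mul hp))⟩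
  -- In terms of `T`, the hypothesis reads: the unnormalized in-degree Laplacian of `u` plus a
  -- combination of harmonic vectors times masses vanishes.
  have key : ∀ y, T.degIn y * u y - ∑' x, T.a y x * u x + (∑' R, c R * T.harm R y) * T.m y = 0 := by
    intro y
    rw [← hP y, ← h y]
    simp only [mul_add]
    rw [Summable.tsum_add (summable_of_finite hu fun x hx => by simp [hu' x hx])
      (summable_of_finite hu fun x hx => by simp [hu' x hx]), K.tsum_mul_lapOut y u]
    congr 2
    · exact mul_comm _ _
    · exact tsum_congr fun x => mul_comm _ _
  -- Pairing with `wt S` kills the Laplacian term by balance and isolates `c S` by biorthogonality.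
  -- What remains is a harmonic `u` orthogonal to all weight vectors.
  have hc0 : ∀ S, c S = 0 := by
    intro S
    have hw : ∀ y, y ∉ {y | T.wt S y ≠ 0} → T.wt S y = 0 := fun y hy => by simpa using hy
    have h1 : ∑' y, T.wt S y * (T.degIn y * u y - ∑' x, T.a y x * u x) = 0 := by
      simp only [mul_sub]
      rw [Summable.tsum_sub (summable_of_finite hu fun x hx => by simp [hu' x hx])
        (summable_of_finite (wt_finite hE S) fun y hy => by simp [hw y hy])]
      simp only [← tsum_mul_left]
      rw [tsum_comm_of_finite, sub_eq_zero]
      · refine tsum_congr fun y => ?_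
        have hb := wt_balance hE S y
        simp only [← mul_assoc, tsum_mul_right]
        rw [hb]
      · refine ((wt_finite hE S).prod hu).subset fun p hp => ?_
        exact ⟨left_ne_zero_of_mul hp, right_ne_zero_of_mul (right_ne_zero_of_mul hp)⟩
    have h2 : ∀ y, T.wt S y * ((∑' R, c R * T.harm R y) * T.m y) = c S * (T.m y * T.wt S y) := by
      classical
      intro y
      by_cases hy : T.wt S y = 0
      · simp [hy]
      · simp only [harm_eq_ite hy]
        rw [tsum_eq_single S (fun R hR => by simp [hR]), if_pos rfl]
        ring
    have h3 : ∑' y, T.wt S y * ((∑' R, c R * T.harm R y) * T.m y) = c S := by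
      rw [tsum_congr h2, tsum_mul_left, tsum_m_mul_wt hE, mul_one]
    have h4 : ∀ y, T.wt S y * ((∑' R, c R * T.harm R y) * T.m y) =
        -(T.wt S y * (T.degIn y * u y - ∑' x, T.a y x * u x)) := fun y => by
      rw [← mul_neg]
      congr 1
      linarith [key y]
    rw [← h3, tsum_congr h4, tsum_neg, h1, neg_zero]
  have hharm : ∀ y, ∑' x, T.a y x * u x = T.degIn y * u y := by
    intro y
    have := key y
    simp only [hc0, zero_mul, tsum_zero] at this
    linarith
  refine le_antisymm (nonpos_of_harmonic hE hu hharm hc0 x) ?_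
  have := nonpos_of_harmonic hE (u := fun x => -u x) (by simpa using hu)
    (fun y => by simp only [mul_neg, tsum_neg, hharm])
    (fun R => by
      simp only [neg_mul, tsum_neg]
      exact neg_eq_zero.2 (hc0 R)) x
  linarith

open Classical in
theorem exists_extendMatrix (hE : K.transpose.edges.Finite) [Fintype K.transpose.endpoints] :
    ∃ N : Matrix K.transpose.endpoints K.transpose.endpoints ℝ, IsUnit N.det ∧
      ∀ x y, K.lapOut x y + K.transpose.wtHarm x y = extendMatrix K.transpose.endpoints N x y := by
  classical
  have hZf : K.transpose.endpoints.Finite := Set.toFinite _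
  set N : Matrix K.transpose.endpoints K.transpose.endpoints ℝ := Matrix.of fun x y => K.lapOut x y + K.transpose.wtHarm x y with hN
  have hext : ∀ x y, K.lapOut x y + K.transpose.wtHarm x y = extendMatrix K.transpose.endpoints N x y := by
    intro x y
    by_cases h : x ∈ K.transpose.endpoints ∧ y ∈ K.transpose.endpoints
    · rw [extendMatrix_of_mem N ⟨x, h.1⟩ ⟨y, h.2⟩]
      rfl
    · rw [extendMatrix, dif_neg h]
      have h' : x ∉ K.transpose.endpoints ∨ y ∉ K.transpose.endpoints := not_and_or.1 h
      rw [lapOut_eq_zero_of_notMem h', wtHarm_of_notMem hE h', zero_add]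
  refine ⟨N, ?_, hext⟩
  rw [isUnit_iff_ne_zero]
  intro hdet
  -- A left null vector is taken because, divided by the masses, it is governed by the in-degree
  -- Laplacian of `T`, to which the maximum principle applies.
  obtain ⟨v, hv, hv0⟩ := Matrix.exists_vecMul_eq_zero_iff.2 hdet
  apply hv
  set u : V → ℝ := fun x => if h : x ∈ K.transpose.endpoints then v ⟨x, h⟩ / K.m x else 0 with hu
  have hu0 : ∀ x, x ∉ K.transpose.endpoints → u x = 0 := fun x hx => by simp [hu, hx]
  have hu1 : ∀ x : K.transpose.endpoints, u x * K.m x = v x := fun x => by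
    simp [hu, div_mul_cancel₀ _ (K.m_pos x).ne']
  have hfin : {x | u x ≠ 0}.Finite := hZf.subset fun x hx => by
    by_contra h
    exact hx (hu0 x h)
  have hz := eq_zero_of_tsum_mul_eq_zero hE hfin fun y => by
    simp only [hext]
    by_cases hy : y ∈ K.transpose.endpoints
    · rw [← tsum_subtype_eq_of_support_subset (s := K.transpose.endpoints), tsum_fintype]
      · have := congrFun hv0 ⟨y, hy⟩
        simp only [Matrix.vecMul, dotProduct, Pi.zero_apply] at this
        rw [← this]
        refine Finset.sum_congr rfl fun x _ => ?_
        rw [hu1, extendMatrix_of_mem N x ⟨y, hy⟩]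
      · intro x hx
        by_contra hxZ
        apply hx
        change u x * _ * _ = 0
        rw [hu0 x hxZ, zero_mul, zero_mul]
    · rw [tsum_eq_single y, hu0 y hy, zero_mul, zero_mul]
      intro x hx
      rw [extendMatrix_of_notMem_right _ _ hy, if_neg hx, mul_zero]
  ext x
  rw [← hu1, hz, zero_mul, Pi.zero_apply]

theorem isUnit_add_comp (hE : K.transpose.edges.Finite)
    {B : WeightedL2 K.m →L[ℂ] WeightedL2 K.m}
    {Jd : WeightedL2 K.m →L[ℂ] WeightedL2 K.transpose.reachMass}
    {Ju : WeightedL2 K.transpose.reachMass →L[ℂ] WeightedL2 K.m}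
    (hB : HasKernel B K.lapOut) (hJd : HasKernel Jd K.transpose.downKernel)
    (hJu : HasKernel Ju K.transpose.upKernel) : IsUnit (B + Ju ∘L Jd) := by
  classical
  have : Fintype K.transpose.endpoints := (endpoints_finite hE).fintype
  obtain ⟨N, hN, hext⟩ := exists_extendMatrix hE
  refine isUnit_of_extendMatrix K.m_pos hN fun x y => ?_
  rw [← hext, _root_.add_apply, WeightedL2.add_apply K.m_pos, hB.apply_delta K.m_pos,
    hJu.comp_apply_delta K.m_pos hJd, tsum_upKernel_mul_downKernel hE]
  push_cast
  rfl

end Cluster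

end WGraph

/-! ### The compressed Laplacian, and the example separating the two reductions. -/

namespace WGraph

open WeightedL2

universe u
variable {V : Type u}

theorem isReducedOut_reducedGraph (G : WGraph V) {F : Set (V × V)}
    (hE : (G.clusterT F).edges.Finite) : G.IsReducedOut F (reducedGraph G hE) := by
  have hm : G.redMassOut F = (G.clusterT F).reachMass := funext fun S => projMass_wt_harm hE S
  refine ⟨hm.symm, ?_⟩
  funext R S
  rw [redWeightOut, hm]
  exact congrArg (· * (G.clusterT F).reachMass S) (tsum_coe_coupling R S).symm

/-- The reduced graph for the in-degree Laplacian, for a finite vertex set. -/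
def reducedGraphIn [Finite V] (G : WGraph V) {F : Set (V × V)}
    (hE : (G.restrict F).edges.Finite) : WGraph (G.restrict F).Reach :=
  have : Finite (G.restrict F).Reach := inferInstanceAs (Finite (Subtype (G.restrict F).IsReach))
  { m := G.redMassIn F
    a := G.redWeightIn F
    m_pos := fun S => (reachMass_pos hE S).trans_eq (projMass_harm_wt hE S).symm
    a_nonneg := fun _ _ => mul_nonneg ((reachMass_pos hE _).le.trans_eq (projMass_harm_wt hE _).symm)
      (tsum_nonneg fun r => tsum_nonneg fun s => mul_nonneg (mul_nonneg
        (wt_nonneg hE _ r) (G.a_nonneg r s)) (harm_nonneg hE _ s))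
    finite_in := fun _ => Set.toFinite _
    finite_out := fun _ => Set.toFinite _ }

/-- The product `harm R v * wt S v` equals `wt S v` if `R = S` and zero otherwise. Hence the degree
term gives the reduced out-degree on the diagonal and the weight term gives the coupling. -/
theorem tsum_downKernel_lapOut_upKernel {G T : WGraph V} (hm : T.m = G.m) (hE : T.edges.Finite)
    (R S : T.Reach) :
    ∑' v, T.downKernel R v * ∑' x, G.lapOut v x * T.upKernel x S =
      (reducedGraph G hE).lapOut R S := by
  classical
  have h1 : ∀ v, T.downKernel R v * ∑' x, G.lapOut v x * T.upKernel x S =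
      (T.reachMass S / T.reachMass R) * ((if R = S then 1 else 0) * (T.wt S v * G.degOut v) -
        ∑' s, T.harm R v * G.a v s * T.wt S s) := by
    intro v
    have h := G.lapOut_tsum_mul (𝕜 := ℝ) v (fun x => T.upKernel x S)
    simp only [RCLike.ofReal_real_eq_id, id] at h
    have h2 : T.harm R v * T.wt S v = (if R = S then 1 else 0) * T.wt S v := by
      by_cases hw : T.wt S v = 0
      · simp [hw]
      · rw [harm_eq_ite hw]
    rw [h, ← mul_assoc _ (T.wt S v), ← h2]
    simp only [upKernel, downKernel, mul_left_comm (G.a _ _), mul_assoc, tsum_mul_left]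
    rw [hm]
    have := (G.m_pos v).ne'
    have := (reachMass_pos hE R).ne'
    field_simp
  have hs : ∀ v, v ∉ {v | T.wt S v ≠ 0} → T.wt S v = 0 := fun v hv => by simpa using hv
  have hr : ∀ v, v ∉ {v | T.harm R v ≠ 0} → T.harm R v = 0 := fun v hv => by simpa using hv
  rw [tsum_congr h1, tsum_mul_left, Summable.tsum_sub, tsum_mul_left, lapOut,
    reducedGraph_degOut]
  · change _ = (_ - coupling G T R S * T.reachMass S) / T.reachMass R
    rw [coupling]
    split_ifs with hRS
    · subst hRS
      ring
    · ring
  · exact summable_of_finite (wt_finite hE S) fun v hv => by simp [hs v hv]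
  · exact summable_of_finite (harm_finite hE R) fun v hv => by simp [hr v hv]

theorem eq_comp_of_hasKernel {G T : WGraph V} (hm : T.m = G.m) (hE : T.edges.Finite)
    {A : WeightedL2 G.m →L[ℂ] WeightedL2 G.m}
    {L : WeightedL2 (reducedGraph G hE).m →L[ℂ] WeightedL2 (reducedGraph G hE).m}
    {Jd : WeightedL2 G.m →L[ℂ] WeightedL2 (reducedGraph G hE).m}
    {Ju : WeightedL2 (reducedGraph G hE).m →L[ℂ] WeightedL2 G.m}
    (hA : HasKernel A G.lapOut) (hL : HasKernel L (reducedGraph G hE).lapOut)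
    (hJd : HasKernel Jd T.downKernel) (hJu : HasKernel Ju T.upKernel) : L = Jd ∘L A ∘L Ju := by
  refine clm_ext (reducedGraph G hE).m_pos fun S R => ?_
  rw [hL.apply_delta (reducedGraph G hE).m_pos, ← tsum_downKernel_lapOut_upKernel hm hE,
    ContinuousLinearMap.comp_apply, hJd, Complex.ofReal_tsum]
  simp only [hA.comp_apply_delta (reducedGraph G hE).m_pos hJu, Complex.ofReal_mul]

theorem isProjOut_of_hasKernel {G : WGraph V} {F : Set (V × V)}
    (hE : (G.clusterT F).edges.Finite)
    {J : WeightedL2 G.m →L[ℂ] WeightedL2 (reducedGraph G hE).m}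
    (hJ : HasKernel J (G.clusterT F).downKernel) : G.IsProjOut F (reducedGraph G hE) J := by
  intro f R
  rw [hJ, ← tsum_div_const]
  refine tsum_congr fun v => ?_
  change (((G.clusterT F).harm R v * G.m v / (G.clusterT F).reachMass R : ℝ) : ℂ) * f v =
    ((G.clusterT F).harm R v : ℂ) * f v * (G.m v : ℂ) / ((G.clusterT F).reachMass R : ℂ)
  push_cast
  ring

theorem isInterpOut_of_hasKernel {G : WGraph V} {F : Set (V × V)}
    (hE : (G.clusterT F).edges.Finite)
    {J : WeightedL2 (reducedGraph G hE).m →L[ℂ] WeightedL2 G.m}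
    (hJ : HasKernel J (G.clusterT F).upKernel) : G.IsInterpOut F (reducedGraph G hE) J := by
  intro f v
  rw [hJ]
  refine tsum_congr fun R => ?_
  change (((G.clusterT F).reachMass R * (G.clusterT F).wt R v : ℝ) : ℂ) * f R =
    ((G.clusterT F).reachMass R : ℂ) * f R * ((G.clusterT F).wt R v : ℂ)
  push_cast
  ring

section Fork

/-- The graph with the two edges from `0` to `1` and from `0` to `2`. -/
def fork : WGraph (Fin 3) where
  m := fun _ => 1
  a := fun i j => if i ≠ 0 ∧ j = 0 then 1 else 0
  m_pos := fun _ => one_pos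
  a_nonneg := fun _ _ => by split_ifs <;> norm_num
  finite_in := fun _ => Set.toFinite _
  finite_out := fun _ => Set.toFinite _

theorem fork_restrict_a (i j : Fin 3) :
    0 < (fork.restrict fork.edges).a i j ↔ i ≠ 0 ∧ j = 0 := by
  by_cases h : i ≠ 0 ∧ j = 0 <;> simp [restrict, edges, fork, h]

/-- Vertex `0` reaches everything, so its reachable set is the only maximal one. -/
theorem subsingleton_reach_fork : Subsingleton (fork.restrict fork.edges).Reach := by
  have h0 : (fork.restrict fork.edges).reachableSet 0 = Set.univ := by
    refine Set.eq_univ_of_forall fun i => ?_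
    by_cases hi : i = 0
    · rw [hi]
      exact mem_reachableSet_self _
    · exact Relation.ReflTransGen.single ((fork_restrict_a i 0).2 ⟨hi, rfl⟩)
  have h : ∀ R : (fork.restrict fork.edges).Reach,
      R.1 = (fork.restrict fork.edges).reachableSet 0 := fun R =>
    R.2.eq_reachableSet (h0 ▸ Set.subset_univ _)
  exact ⟨fun R S => Subtype.ext ((h R).trans (h S).symm)⟩

/-- After reversal the vertices `1` and `2` see nobody but themselves, so the root that each of them
sees is the vertex itself. -/
theorem exists_reach_fork (hE : (fork.clusterT fork.edges).edges.Finite) {i : Fin 3}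
    (hi : i ≠ 0) : ∃ R : (fork.clusterT fork.edges).Reach,
      R.1 = (fork.clusterT fork.edges).reachableSet i := by
  obtain ⟨j, hj, hs⟩ := exists_isReach_sees hE i
  have : i = j := (sees_iff_of_notMem fun w h => hi ((fork_restrict_a w i).1 h).2).1 hs
  subst this
  exact ⟨⟨_, hj⟩, rfl⟩

theorem not_isomorphic_fork {H : WGraph (fork.clusterT fork.edges).Reach}
    {H' : WGraph (fork.restrict fork.edges).Reach} : ¬ H.Isomorphic H' := by
  rintro ⟨e, -⟩
  have hE : (fork.clusterT fork.edges).edges.Finite := Set.toFinite _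
  obtain ⟨R, hR⟩ := exists_reach_fork hE (i := 1) (by decide)
  obtain ⟨S, hS⟩ := exists_reach_fork hE (i := 2) (by decide)
  have := subsingleton_reach_fork
  have hRS : R = S := e.injective (Subsingleton.elim _ _)
  have h1 : (1 : Fin 3) ∈ (fork.clusterT fork.edges).reachableSet 2 := by
    rw [← hS, ← hRS, hR]
    exact mem_reachableSet_self _
  have h2 : (1 : Fin 3) = 2 := (sees_iff_of_notMem fun w h =>
    absurd ((fork_restrict_a w 1).1 h).2 (by decide)).1 h1
  exact absurd h2 (by decide)

end Fork

end WGraph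

end

theorem mainTheorem4 :
    (∀ (V : Type*) [Countable V] (G : WGraph V) (_ : G.DegreeBounded)
        (F : Set (V × V)) (_ : F ⊆ G.edges) (_ : F.Finite),
      ∃ H : WGraph (G.clusterT F).Reach, G.IsReducedOut F H ∧ H.DegreeBounded ∧
      ∃ (A B : WeightedL2 G.m →L[ℂ] WeightedL2 G.m)
        (L : WeightedL2 H.m →L[ℂ] WeightedL2 H.m)
        (Jdown : WeightedL2 G.m →L[ℂ] WeightedL2 H.m)
        (Jup : WeightedL2 H.m →L[ℂ] WeightedL2 G.m),
        (G.restrict Fᶜ).IsOutLaplacian A ∧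
        (G.restrict F).IsOutLaplacian B ∧
        H.IsOutLaplacian L ∧
        G.IsProjOut F H Jdown ∧
        G.IsInterpOut F H Jup ∧
        IsRieszProjAtZero B (Jup ∘L Jdown) ∧
        ∀ z ∈ resolventSet ℂ L, ∃ C : ℝ, 0 < C ∧ ∃ β₀ : ℝ, 0 < β₀ ∧ ∀ β : ℝ, β₀ ≤ β →
          z ∈ resolventSet ℂ (A + (β : ℂ) • B) ∧
          ‖Ring.inverse (A + (β : ℂ) • B - algebraMap ℂ _ z) -
            Jup ∘L Ring.inverse (L - algebraMap ℂ _ z) ∘L Jdown‖ ≤ C / β) ∧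
    (∃ (G : WGraph (Fin 3)) (F : Set (Fin 3 × Fin 3)), F ⊆ G.edges ∧
      ∃ (Hout : WGraph (G.clusterT F).Reach) (Hin : WGraph (G.restrict F).Reach),
        G.IsReducedOut F Hout ∧ G.IsReducedIn F Hin ∧ ¬ Hout.Isomorphic Hin) := by
  constructor
  · intro V _ G hG F _ hF
    have hE : (G.clusterT F).edges.Finite :=
      WGraph.transpose_edges_finite (WGraph.restrict_edges_finite hF)
    have hH := WGraph.reducedGraph_degreeBounded (T := G.clusterT F) (G := G) hE rfl hG
    have hMpos := WGraph.reachMass_pos hE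
    -- The full Laplacian `A₀ = A + B` enters because the reduced weights are built from all edges
    -- of `G`. Since `B Ju = 0`, its compression agrees with that of `A`.
    obtain ⟨A₀, hA₀⟩ := hG.exists_hasKernel
    obtain ⟨A, hA⟩ : ∃ A : WeightedL2 G.m →L[ℂ] WeightedL2 G.m,
      WeightedL2.HasKernel A (G.restrict Fᶜ).lapOut := (hG.restrict Fᶜ).exists_hasKernel
    obtain ⟨B, hB⟩ : ∃ B : WeightedL2 G.m →L[ℂ] WeightedL2 G.m,
      WeightedL2.HasKernel B (G.restrict F).lapOut := (hG.restrict F).exists_hasKernel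
    obtain ⟨L, hL⟩ := hH.exists_hasKernel
    obtain ⟨Jd, hJd⟩ : ∃ J : WeightedL2 G.m →L[ℂ] WeightedL2 (G.clusterT F).reachMass,
      WeightedL2.HasKernel J (G.clusterT F).downKernel :=
      (WGraph.schurKernel_downKernel hE).exists_clm G.m_pos hMpos
    obtain ⟨Ju, hJu⟩ : ∃ J : WeightedL2 (G.clusterT F).reachMass →L[ℂ] WeightedL2 G.m,
      WeightedL2.HasKernel J (G.clusterT F).upKernel :=
      (WGraph.schurKernel_upKernel hE).exists_clm hMpos G.m_pos
    have hJ : Jd ∘L Ju = 1 := WeightedL2.clm_ext hMpos fun S R => by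
      rw [WeightedL2.HasKernel.comp_apply_delta hMpos hJd hJu,
        WGraph.tsum_downKernel_mul_upKernel hE, WeightedL2.one_apply_delta hMpos]
    have hBJ : B ∘L Ju = 0 := WeightedL2.clm_ext hMpos fun S v => by
      rw [WeightedL2.HasKernel.comp_apply_delta hMpos hB hJu,
        WGraph.tsum_lapOut_mul_upKernel hE, Complex.ofReal_zero]
      exact (WeightedL2.zero_apply G.m_pos v).symm
    have hJB : Jd ∘L B = 0 := WeightedL2.clm_ext G.m_pos fun v R => by
      rw [WeightedL2.HasKernel.comp_apply_delta G.m_pos hJd hB,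
        WGraph.tsum_downKernel_mul_lapOut hE, Complex.ofReal_zero]
      exact (WeightedL2.zero_apply hMpos R).symm
    have hAB : A + B = A₀ := WeightedL2.clm_ext G.m_pos fun v w => by
      rw [add_apply, WeightedL2.add_apply G.m_pos, hA.apply_delta G.m_pos,
        hB.apply_delta G.m_pos, hA₀.apply_delta G.m_pos, ← WGraph.lapOut_restrict_add (G := G) F,
        Complex.ofReal_add]
    have hA₀J : A₀ ∘L Ju = A ∘L Ju := by
      rw [← hAB, ContinuousLinearMap.add_comp, hBJ, add_zero]
    have hLA : L = Jd ∘L A ∘L Ju :=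
      (WGraph.eq_comp_of_hasKernel (G := G) (T := G.clusterT F) rfl hE hA₀ hL hJd hJu).trans
        (congrArg (fun S => Jd ∘L S) hA₀J)
    have hu := WGraph.isUnit_add_comp hE hB hJd hJu
    exact ⟨WGraph.reducedGraph G hE, G.isReducedOut_reducedGraph hE, hH, A, B, L, Jd, Ju,
      (WGraph.isOutLaplacian_iff _).2 hA, (WGraph.isOutLaplacian_iff _).2 hB,
      (WGraph.isOutLaplacian_iff _).2 hL, WGraph.isProjOut_of_hasKernel hE hJd,
      WGraph.isInterpOut_of_hasKernel hE hJu, isRieszProjAtZero_comp hJ hBJ hJB hu,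
      fun z hz => exists_norm_resolvent_sub_le hJ hBJ hJB hLA hu hz⟩
  · have hE : (WGraph.fork.clusterT WGraph.fork.edges).edges.Finite := Set.toFinite _
    have hE' : (WGraph.fork.restrict WGraph.fork.edges).edges.Finite := Set.toFinite _
    exact ⟨WGraph.fork, WGraph.fork.edges, subset_rfl, WGraph.reducedGraph WGraph.fork hE,
      WGraph.reducedGraphIn WGraph.fork hE', WGraph.isReducedOut_reducedGraph _ hE, ⟨rfl, rfl⟩,
      WGraph.not_isomorphic_fork⟩
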